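/- Consider a rigid satellite of unit mass with principal moments of inertia $I_1,I_2,I_3$ satisfying $I_1+I_2+I_3=1$ and $0<I_i<\tfrac12$, $\mathbf I=\operatorname{diag}(I_1,I_2,I_3)$, moving in a central gravitational field in the second order approximation: the configuration is $(B,\mathbf R)\in SO(3)\times(\mathbb R^3\setminus\{0\})$ (attitude, and position of the centre of mass in body coordinates, so that the position in space is $B\mathbf R$), and the dynamics on $T^*(SO(3)\times(\mathbb R^3\setminus\{0\}))$ is the Hamiltonian system with Hamiltonian $H=K+V_2$, where, with $\Omega$ the body angular velocity, $$K=\tfrac12\bigl(\Omega\cdot\mathbf I\Omega+|\dot{\mathbf R}+\Omega\times\mathbf R|^2\bigr),\qquad V_2(\mathbf R)=-\frac1R-\frac1{2R^3}+\frac{3}{2R^5}\,\mathbf R\cdot\mathbf I\mathbf R,\qquad R=|\mathbf R|.$$ It is invariant under $G=SO(3)\times\Gamma$, $\Gamma=\{\operatorname{diag}(\pm1,\pm1,\pm1)\}$, acting by the lift of $(M,A)\cdot(B,\mathbf R)=(\det(A)MBA^T,A\mathbf R)$, with momentum map $\mathbf J$ the total angular momentum in space. A relative equilibrium with angular velocity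 $\xi\in\mathbb R^3\cong\mathfrak{so}(3)$ is a phase point $z$ whose evolution is $t\mapsto e^{t\hat\xi}\cdot z$, with $\hat\xi u=\xi\times u$; it is orthogonal if $B\mathbf R\cdot\xi=0$. It is $G_\mu$-stable ($\mu=\mathbf J(z)$) if for every $G_\mu$-invariant neighbourhood $U$ of $G_\mu\cdot z$ there is a neighbourhood $O$ of $z$ such that the evolution of every point of $O$ exists and remains in $U$ for all time. It is linearly unstable if the linearization, at the corresponding equilibrium, of the reduced Hamiltonian vector field on the quotient of the phase space by $SO(3)$ has an eigenvalue with positive real part. Assume the Lagrange conditions $I_1>I_3>I_2$ and let $\mathcal F$ be the set of orthogonal relative equilibria with $\mathbf R$ parallel to the second principal axis and $B^T\xi$ parallel to the first one. Then for each radius $R>0$ the elements of $\mathcal F$ with $|\mathbf R|=R$ form exactly one $G$-orbit, and there is $R_{\mathrm{crit}}\in(0,2)$, a root of $$2R^4+(9I_2-6I_1-3)R^2-15I_1+45I_1I_2=0,$$ such that: 1. (Loss of stability at $R_{\mathrm{crit}}$.) Elements of $\mathcal F$ with $|\mathbf R|>R_{\mathrm{crit}}$ are $G_\mu$-stable; elements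 of $\mathcal F$ with $|\mathbf R|<R_{\mathrm{crit}}$ are linearly unstable and not $G_\mu$-stable. 2. (No bifurcation at $R_{\mathrm{crit}}$.) Every $z\in\mathcal F$ with $|\mathbf R|=R_{\mathrm{crit}}$ has a neighbourhood in phase space in which every relative equilibrium belongs to $\mathcal F$. Thus no other family of relative equilibria emanates there. 3. (Nondegeneracy.) Consider the equations $$\xi\times\bigl(\mathbf I\xi-(\mathbf R\cdot\xi)\mathbf R+|\mathbf R|^2\xi\bigr)=0,\qquad \nabla V_2(\mathbf R)+(\mathbf R\cdot\xi)\,\xi-|\xi|^2\mathbf R=0$$ for relative equilibria at $B=\mathrm{Id}$. At $\mathbf R=(0,R_{\mathrm{crit}},0)$, $\xi=(\xi_1,0,0)$ with $\xi_1^2=\dfrac{2R_{\mathrm{crit}}^2+3-9I_2}{2R_{\mathrm{crit}}^5}$, the $5\times5$ Jacobian determinant, with respect to $(\xi_1,\xi_2,\xi_3,R_1,R_3)$, of the last two components of the first equation and the three components of the second one, is nonzero. -/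

import Mathlib

open scoped Matrix Topology

noncomputable section

namespace Satellite

/-! Second order model of a rigid satellite in a central gravitational field. Units are such that the
satellite has unit mass, its inertia tensor has trace one and `G m₁ = 1`. The body frame consists of
principal axes, so the inertia tensor is `diag (I 0, I 1, I 2)`. -/

abbrev Vec3 := Fin 3 → ℝ

abbrev SO3 := Matrix.specialOrthogonalGroup (Fin 3) ℝ

/-- Euclidean length. -/
def len (R : Vec3) : ℝ := √(R ⬝ᵥ R)

/-- The matrix `û` with `û v = u × v`. -/
def hat (u : Vec3) : Matrix (Fin 3) (Fin 3) ℝ :=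
  !![0, -u 2, u 1; u 2, 0, -u 0; -u 1, u 0, 0]

theorem hat_mulVec (u v : Vec3) : hat u *ᵥ v = u ⨯₃ v := by
  ext i
  fin_cases i <;> simp [hat, Matrix.mulVec, dotProduct, Fin.sum_univ_three, cross_apply] <;> ring

/-- The inertia tensor acting on a vector. -/
def inertia (I : Fin 3 → ℝ) (v : Vec3) : Vec3 := fun i => I i * v i

/-- Second order approximation `V₂` of the gravitational potential, in body coordinates. -/
def potential (I : Fin 3 → ℝ) (R : Vec3) : ℝ :=
  -(1 / len R) - 1 / (2 * len R ^ 3) + 3 / (2 * len R ^ 5) * (R ⬝ᵥ inertia I R)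

/-- Kinetic energy at the configuration `(B, R)` (body coordinates) of the tangent vector `(Ω, R')`,
where `B' = B Ω̂`: here `R' + Ω × R` is the velocity of the centre of mass in the body frame. -/
def kinetic (I : Fin 3 → ℝ) (R Ω R' : Vec3) : ℝ :=
  (Ω ⬝ᵥ inertia I Ω + (R' + Ω ⨯₃ R) ⬝ᵥ (R' + Ω ⨯₃ R)) / 2

/-- A point `(R, Π, P)`: the position `R` of the centre of mass in body coordinates, the momentum `Π`
conjugate to the body angular velocity `Ω`, and the momentum `P` conjugate to `R`. -/
abbrev BodyState := Vec3 × Vec3 × Vec3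

/-- The cotangent bundle of the configuration space `SO(3) × ℝ³`, in body coordinates and with
`T* SO(3)` left trivialized; the point is `(B, R, Π, P)`. (The dynamics lives where `R ≠ 0`.) -/
abbrev Phase := SO3 × BodyState

/-- Legendre transform of the kinetic energy: `(Ω, R') ↦ (Π, P)`. -/
def legendre (I : Fin 3 → ℝ) (R Ω R' : Vec3) : BodyState :=
  (R, inertia I Ω + R ⨯₃ (R' + Ω ⨯₃ R), R' + Ω ⨯₃ R)

/-- The Hamiltonian `H₂ = K + V₂`. It does not depend on the attitude `B`. -/
def hamiltonian (I : Fin 3 → ℝ) (y : BodyState) : ℝ :=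
  (∑ i, (y.2.1 i - (y.1 ⨯₃ y.2.2) i) ^ 2 / I i + y.2.2 ⬝ᵥ y.2.2) / 2 + potential I y.1

theorem hamiltonian_legendre (I : Fin 3 → ℝ) (hI : ∀ i, I i ≠ 0) (R Ω R' : Vec3) :
    hamiltonian I (legendre I R Ω R') = kinetic I R Ω R' + potential I R := by
  have h (i : Fin 3) : (I i * Ω i) ^ 2 / I i = Ω i * (I i * Ω i) := by
    field_simp [hI i]
  simp [hamiltonian, legendre, kinetic, inertia, dotProduct, h]

/-- Fibre derivatives of the kinetic energy give the Legendre transform. -/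
theorem legendre_eq_fibre_derivative (I : Fin 3 → ℝ) (R Ω R' ω v : Vec3) :
    HasDerivAt (fun s : ℝ => kinetic I R (Ω + s • ω) (R' + s • v))
      ((legendre I R Ω R').2.1 ⬝ᵥ ω + (legendre I R Ω R').2.2 ⬝ᵥ v) 0 := by
  have key : (fun s : ℝ => kinetic I R (Ω + s • ω) (R' + s • v)) = fun s : ℝ =>
      kinetic I R Ω R' + s * ((legendre I R Ω R').2.1 ⬝ᵥ ω + (legendre I R Ω R').2.2 ⬝ᵥ v)
        + s ^ 2 * kinetic I R ω v := by
    funext s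
    simp [kinetic, legendre, inertia, dotProduct, Fin.sum_univ_three, cross_apply, Matrix.vecHead,
      Matrix.vecTail]
    ring
  rw [key]
  have h1 := ((hasDerivAt_id (0 : ℝ)).mul_const
    ((legendre I R Ω R').2.1 ⬝ᵥ ω + (legendre I R Ω R').2.2 ⬝ᵥ v)).const_add (kinetic I R Ω R')
  have h2 := ((hasDerivAt_id (0 : ℝ)).pow 2).mul_const (kinetic I R ω v)
  exact (h1.add h2).congr_deriv (by simp)

/-- `∂H/∂R`. -/
def gradR (I : Fin 3 → ℝ) (y : BodyState) : Vec3 :=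
  fun i => fderiv ℝ (hamiltonian I) y (Pi.single i 1, 0, 0)

/-- `∂H/∂Π`, the body angular velocity `Ω`. -/
def gradPi (I : Fin 3 → ℝ) (y : BodyState) : Vec3 :=
  fun i => fderiv ℝ (hamiltonian I) y (0, Pi.single i 1, 0)

/-- `∂H/∂P`. -/
def gradP (I : Fin 3 → ℝ) (y : BodyState) : Vec3 :=
  fun i => fderiv ℝ (hamiltonian I) y (0, 0, Pi.single i 1)

/-- The `(R, Π, P)` components of the Hamiltonian vector field. As `H` does not depend on `B`, this is
also the reduced Hamiltonian vector field on the quotient of the phase space by `SO(3)`. -/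
def bodyField (I : Fin 3 → ℝ) (y : BodyState) : BodyState :=
  (gradP I y, y.2.1 ⨯₃ gradPi I y, -gradR I y)

/-- The canonical symplectic form of the cotangent bundle at a point with body momentum `Π`; tangent
vectors are `(δθ, δR, δΠ, δP)` with `δB = B δθ̂`. -/
def symplecticForm (Pi0 : Vec3) (v w : Vec3 × BodyState) : ℝ :=
  v.1 ⬝ᵥ w.2.2.1 - w.1 ⬝ᵥ v.2.2.1 + Pi0 ⬝ᵥ (v.1 ⨯₃ w.1)
    + v.2.1 ⬝ᵥ w.2.2.2 - w.2.1 ⬝ᵥ v.2.2.2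

/-- The vector field with `B' = B Ω̂`, `Ω = ∂H/∂Π`, and body components `bodyField` is the Hamiltonian
vector field of `H` for the canonical symplectic form. -/
theorem symplecticForm_bodyField (I : Fin 3 → ℝ) (y : BodyState) (w : Vec3 × BodyState) :
    symplecticForm y.2.1 (gradPi I y, bodyField I y) w = fderiv ℝ (hamiltonian I) y w.2 := by
  obtain ⟨θ, a, b, c⟩ := w
  have hdec : ((a, b, c) : BodyState) =
      ∑ i, (a i • ((Pi.single i 1, 0, 0) : BodyState) + b i • ((0, Pi.single i 1, 0) : BodyState)
        + c i • ((0, 0, Pi.single i 1) : BodyState)) := by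
    refine Prod.ext ?_ (Prod.ext ?_ ?_) <;> ext j <;> fin_cases j <;>
      simp [Fin.sum_univ_three]
  rw [show ((θ, a, b, c) : Vec3 × BodyState).2 = (a, b, c) from rfl, hdec, map_sum]
  simp only [map_add, map_smul, smul_eq_mul]
  simp [symplecticForm, bodyField, dotProduct, Fin.sum_univ_three, cross_apply, gradR, gradPi, gradP]
  ring

/-- Evolutions of the Hamiltonian system that are defined for all time. -/
def IsEvolution (I : Fin 3 → ℝ) (γ : ℝ → Phase) : Prop :=
  ∀ t, (γ t).2.1 ≠ 0 ∧
    HasDerivAt (fun s => (γ s).2) (bodyField I (γ t).2) t ∧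
    ∀ i j, HasDerivAt (fun s => (γ s).1.1 i j) (((γ t).1.1 * hat (gradPi I (γ t).2)) i j) t

/-- `z` is a relative equilibrium with angular velocity `ξ` (in space coordinates): its evolution is
`t ↦ exp (t ξ̂) · z`. -/
def IsRelEq (I : Fin 3 → ℝ) (z : Phase) (ξ : Vec3) : Prop :=
  ∃ γ : ℝ → Phase, IsEvolution I γ ∧
    ∀ t, (γ t).1.1 = NormedSpace.exp (t • hat ξ) * z.1.1 ∧ (γ t).2 = z.2

/-- Orthogonality of the position `r = B R` and the angular velocity `ξ`, both in space coordinates. -/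
def IsOrthogonal (z : Phase) (ξ : Vec3) : Prop := (z.1.1 *ᵥ z.2.1) ⬝ᵥ ξ = 0

/-- The group of discrete symmetries, `{diag (±1, ±1, ±1)}`. -/
abbrev Signs := Fin 3 → ℤˣ

/-- The rotation `det A • Aᵀ` for `A = diag ε`. -/
def signRot (ε : Signs) : SO3 :=
  ⟨Matrix.diagonal fun i => (((∏ j, ε j) * ε i : ℤˣ) : ℤ), by
    rw [Matrix.mem_specialOrthogonalGroup_iff, Matrix.mem_orthogonalGroup_iff]
    have h (a : ℤˣ) : ((a : ℤ) : ℝ) * ((a : ℤ) : ℝ) = 1 := by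
      rcases Int.units_eq_one_or a with rfl | rfl <;> simp
    refine ⟨?_, ?_⟩
    · rw [Matrix.diagonal_transpose,
        Matrix.diagonal_mul_diagonal, ← Matrix.diagonal_one]
      refine congrArg Matrix.diagonal (funext fun i => ?_)
      simpa using h ((∏ j, ε j) * ε i)
    · rw [Matrix.det_diagonal]
      have := h (ε 0)
      have := h (ε 1)
      have := h (ε 2)
      simp only [Fin.prod_univ_three, Units.val_mul, Int.cast_mul]
      grind⟩

/-- The symmetry group `SO(3) × {diag (±1, ±1, ±1)}`. -/
abbrev Sym := SO3 × Signs

/-- Componentwise sign change, i.e. the action of `A = diag ε` on `ℝ³`. -/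
def signAct (ε : Signs) (v : Vec3) : Vec3 := fun i => ((ε i : ℤ) : ℝ) * v i

/-- The cotangent lift of `(M, A) · (B, R) = (det A • M B Aᵀ, A R)`. -/
def act (g : Sym) (z : Phase) : Phase :=
  (g.1 * z.1 * signRot g.2,
    signAct g.2 z.2.1, ((∏ j, g.2 j : ℤˣ) : ℤ) • signAct g.2 z.2.2.1, signAct g.2 z.2.2.2)

/-- The momentum map: total angular momentum in space coordinates. -/
def momentum (z : Phase) : Vec3 := z.1.1 *ᵥ z.2.2.1

/-- The stabilizer of `μ` for the coadjoint action of the symmetry group. -/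
def stabilizer (μ : Vec3) : Set Sym := {g | g.1.1 *ᵥ μ = μ}

/-- `G_μ`-stability of `z`, with `μ` the momentum of `z`: every `G_μ`-invariant neighbourhood of
`G_μ · z` contains for all time the evolution of all points near `z`. -/
def IsStable (I : Fin 3 → ℝ) (z : Phase) : Prop :=
  ∀ U : Set Phase,
    U ∈ 𝓝ˢ ((fun g => act g z) '' stabilizer (momentum z)) →
    (∀ g ∈ stabilizer (momentum z), ∀ x ∈ U, act g x ∈ U) →
    ∃ O ∈ 𝓝 z, ∀ x ∈ O, ∃ γ : ℝ → Phase, IsEvolution I γ ∧ γ 0 = x ∧ ∀ t, γ t ∈ U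

/-- Linear instability of a relative equilibrium: the linearization of the reduced Hamiltonian vector
field at the corresponding equilibrium has an eigenvalue with positive real part. -/
def IsLinearlyUnstable (I : Fin 3 → ℝ) (z : Phase) : Prop :=
  ∃ c : ℂ, 0 < c.re ∧
    Polynomial.aeval c (fderiv ℝ (bodyField I) z.2 : BodyState →ₗ[ℝ] BodyState).charpoly = 0

/-- The family of orthogonal relative equilibria with the centre of mass on the second principal axis
and the angular velocity (in the body frame, `Bᵀ ξ`) along the first principal axis. -/
def orthFamily (I : Fin 3 → ℝ) : Set Phase :=
  {z | ∃ ξ : Vec3, IsRelEq I z ξ ∧ IsOrthogonal z ξ ∧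
    (z.2.1 0 = 0 ∧ z.2.1 2 = 0) ∧ ((z.1.1ᵀ *ᵥ ξ) 1 = 0 ∧ (z.1.1ᵀ *ᵥ ξ) 2 = 0)}

/-- `z` is a bifurcation point of the family `F`: arbitrarily close to `z` there are relative equilibria
that do not belong to `F`. -/
def IsBifurcationPoint (I : Fin 3 → ℝ) (F : Set Phase) (z : Phase) : Prop :=
  ∀ N ∈ 𝓝 z, ∃ x ∈ N, (∃ ξ, IsRelEq I x ξ) ∧ x ∉ F

/-- The gradient of the potential. -/
def gradPotential (I : Fin 3 → ℝ) (R : Vec3) : Vec3 :=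
  fun i => fderiv ℝ (potential I) R (Pi.single i 1)

/-- The left-hand sides of the relative equilibrium equations at `B = Id`, for `y = (R, ξ)`:
`ξ × (I ξ - R (R · ξ) + |R|² ξ) = 0` and `∇V₂(R) + (R · ξ) ξ - |ξ|² R = 0`. -/
def relEqMap (I : Fin 3 → ℝ) (y : Vec3 × Vec3) : Vec3 × Vec3 :=
  (y.2 ⨯₃ (inertia I y.2 - (y.1 ⬝ᵥ y.2) • y.1 + (y.1 ⬝ᵥ y.1) • y.2),
    gradPotential I y.1 + (y.1 ⬝ᵥ y.2) • y.2 - (y.2 ⬝ᵥ y.2) • y.1)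

/-- The `5 × 5` block of the Jacobian of `relEqMap` for the variables `ξ₁, ξ₂, ξ₃, R₁, R₃`. The first
component of `relEqMap` is left out: its differential vanishes along the orthogonal family. -/
def relEqJacobian (I : Fin 3 → ℝ) (y : Vec3 × Vec3) : Matrix (Fin 5) (Fin 5) ℝ :=
  Matrix.of fun i j =>
    fderiv ℝ (fun x => (![(relEqMap I x).1 1, (relEqMap I x).1 2, (relEqMap I x).2 0,
        (relEqMap I x).2 1, (relEqMap I x).2 2] : Fin 5 → ℝ) i) y
      ((![(0, Pi.single 0 1), (0, Pi.single 1 1), (0, Pi.single 2 1), (Pi.single 0 1, 0),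
        (Pi.single 2 1, 0)] : Fin 5 → Vec3 × Vec3) j)

end Satellite

end

/-!
Write `a = I₀ + r²` for the moment of inertia of a member of the family at the position
`(0, r, 0)`, `w` for its angular velocity and `Π₀` for its body momentum, `|Π₀| = a |w|`. Indices
run over `0, 1, 2`.

*The family.* As the Hamiltonian `H` does not depend on the attitude, relative equilibria are the
equilibria of the body equations, with `ξ = B Ω` (`isRelEq_iff`). On the axis of the family these
leave one equation, `w² = freqSq I |r|`, and the symmetry group permutes the signs of `r` and `w`
(`orthFamily_orbit`).

*Stability.* The function `H - |Π|² / (2a) + N (|Π|² - |Π₀|²)²` is conserved, and the equilibrium is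
a critical point of it. The quadratic form in its second variation without the last term
(`secondVariation`) splits into four blocks. For `I₀ > I₂ > I₁` it is positive on the kernel of
`d|Π|²` exactly when the curvature of the amended potential in the radial direction is positive, and
this curvature has the sign of `critPoly` (`radial_curvature_eq`). By Finsler's lemma a large `N`
makes the second variation positive definite, which confines the body variables to a small
neighbourhood for all time. The space momentum `B Π` is conserved, and by compactness of `SO(3)` the
pairs of body variables and space momentum near those of `z` determine a neighbourhood of the
`G_μ`-orbit of `z`; so `z` is `G_μ`-stable (`isStable_of_conserved`). Evolutions exist for all time
since they agree with those of a bounded Lipschitz field.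

*Instability.* If `critPoly` is negative, the linearization `L` has a functional `u` with
`u ∘ L² = s u` for some `s > 0` (`exists_unstable_mode`), hence the eigenvalue `√s`. To deduce
nonlinear instability, take `F = u · (u ∘ L)`, whose derivative along the flow is
`(u ∘ L)² + s u²` up to higher order terms. The second variation is positive on the kernel of
`d|Π|²` intersected with `ker u`, so that for the conserved function `E` above and large `N`, the
function `2 E + N F'` has a strict minimum at the equilibrium. A solution that starts with `E` below
its equilibrium value has `F'` bounded below by a positive constant as long as it stays near the
equilibrium, and therefore it leaves (`not_isStable_of_deficit`).

*No bifurcation.* For a relative equilibrium near the family, the equations force the components of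
position and angular velocity that vanish on the family to vanish: first those with index `2`, then
`R · Ω`, then the others (`orthogonal_of_relEq_equations`). The second variation in the
radial direction, which degenerates at the critical radius, plays no role. For the same reason the
`5 × 5` Jacobian, which is sparse, is invertible on the whole family
(`det_relEqJacobian_axis_ne_zero`).
-/

noncomputable section

namespace Satellite

/-! ### Derivatives of the Hamiltonian -/

/-- The body angular velocity, from the inverse Legendre transform. -/
def omega (I : Fin 3 → ℝ) (y : BodyState) : Vec3 :=
  fun i => (y.2.1 i - (y.1 ⨯₃ y.2.2) i) / I i

/-- The gradient of the potential in closed form. -/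
def gradV (I : Fin 3 → ℝ) (R : Vec3) : Vec3 := fun i =>
  R i * (1 / len R ^ 3 + 3 / (2 * len R ^ 5) - 15 / (2 * len R ^ 7) * (R ⬝ᵥ inertia I R)
    + 3 * I i / len R ^ 5)

theorem dotProduct_self_pos {R : Vec3} (hR : R ≠ 0) : 0 < R ⬝ᵥ R :=
  lt_of_le_of_ne (Finset.sum_nonneg fun _ _ => mul_self_nonneg _) fun h =>
    hR (dotProduct_self_eq_zero.mp h.symm)

theorem len_pos {R : Vec3} (hR : R ≠ 0) : 0 < len R := Real.sqrt_pos.2 (dotProduct_self_pos hR)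

theorem contDiffAt_len {R : Vec3} (hR : R ≠ 0) : ContDiffAt ℝ 2 len R := by
  unfold len
  refine ContDiffAt.sqrt ?_ (dotProduct_self_pos hR).ne'
  simp only [dotProduct, Fin.sum_univ_three]
  fun_prop

theorem contDiffAt_potential (I : Fin 3 → ℝ) {R : Vec3} (hR : R ≠ 0) :
    ContDiffAt ℝ 2 (potential I) R := by
  have h := (len_pos hR).ne'
  have := contDiffAt_len hR
  unfold potential
  simp only [dotProduct, inertia, Fin.sum_univ_three]
  refine ((ContDiffAt.div contDiffAt_const this h).neg.sub (ContDiffAt.div contDiffAt_const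
    (by fun_prop) (by positivity))).add ((ContDiffAt.div contDiffAt_const (by fun_prop)
    (by positivity)).mul (by fun_prop))

theorem contDiffAt_gradV (I : Fin 3 → ℝ) {R : Vec3} (hR : R ≠ 0) :
    ContDiffAt ℝ 2 (gradV I) R := by
  have h := (len_pos hR).ne'
  have := contDiffAt_len hR
  unfold gradV
  simp only [dotProduct, inertia, Fin.sum_univ_three]
  refine contDiffAt_pi.2 fun i => ContDiffAt.mul (by fun_prop) ?_
  refine (((ContDiffAt.div contDiffAt_const (by fun_prop) (by positivity)).add
    (ContDiffAt.div contDiffAt_const (by fun_prop) (by positivity))).sub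
    ((ContDiffAt.div contDiffAt_const (by fun_prop) (by positivity)).mul (by fun_prop))).add
    (ContDiffAt.div contDiffAt_const (by fun_prop) (by positivity))

theorem contDiffAt_hamiltonian (I : Fin 3 → ℝ) {y : BodyState} (hR : y.1 ≠ 0) :
    ContDiffAt ℝ 2 (hamiltonian I) y := by
  have h1 : ContDiffAt ℝ 2 (fun y : BodyState => potential I y.1) y :=
    (contDiffAt_potential I hR).comp y contDiffAt_fst
  unfold hamiltonian
  refine ContDiffAt.add ?_ h1
  simp only [dotProduct, Fin.sum_univ_three, cross_apply, Matrix.cons_val]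
  fun_prop

theorem hasDerivAt_len_line {R : Vec3} (hR : R ≠ 0) (v : Vec3) :
    HasDerivAt (fun t : ℝ => len (R + t • v)) ((R ⬝ᵥ v) / len R) 0 := by
  have h0 : (fun t : ℝ => (R + t • v) ⬝ᵥ (R + t • v)) =
      fun t => R ⬝ᵥ R + t * (2 * (R ⬝ᵥ v)) + t ^ 2 * (v ⬝ᵥ v) := by
    funext t
    simp only [dotProduct, Fin.sum_univ_three, Pi.add_apply, Pi.smul_apply, smul_eq_mul]
    ring
  have h1 : HasDerivAt (fun t : ℝ => (R + t • v) ⬝ᵥ (R + t • v)) (2 * (R ⬝ᵥ v)) 0 := by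
    rw [h0]
    have h1 := ((hasDerivAt_id (0 : ℝ)).mul_const (2 * (R ⬝ᵥ v))).const_add (R ⬝ᵥ R)
    have h2 := ((hasDerivAt_id (0 : ℝ)).pow 2).mul_const (v ⬝ᵥ v)
    exact (h1.add h2).congr_deriv (by simp)
  have h2 := h1.sqrt (by simpa using (dotProduct_self_pos hR).ne')
  refine h2.congr_deriv ?_
  simp only [zero_smul, add_zero, len]
  ring

theorem hasDerivAt_inertia_line (I : Fin 3 → ℝ) (R v : Vec3) :
    HasDerivAt (fun t : ℝ => (R + t • v) ⬝ᵥ inertia I (R + t • v))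
      (2 * (R ⬝ᵥ inertia I v)) 0 := by
  have h0 : (fun t : ℝ => (R + t • v) ⬝ᵥ inertia I (R + t • v)) =
      fun t => R ⬝ᵥ inertia I R + t * (2 * (R ⬝ᵥ inertia I v)) + t ^ 2 * (v ⬝ᵥ inertia I v) := by
    funext t
    simp only [dotProduct, inertia, Fin.sum_univ_three, Pi.add_apply, Pi.smul_apply, smul_eq_mul]
    ring
  rw [h0]
  have h1 := ((hasDerivAt_id (0 : ℝ)).mul_const (2 * (R ⬝ᵥ inertia I v))).const_add
    (R ⬝ᵥ inertia I R)
  have h2 := ((hasDerivAt_id (0 : ℝ)).pow 2).mul_const (v ⬝ᵥ inertia I v)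
  exact (h1.add h2).congr_deriv (by simp)

theorem fderiv_potential_apply (I : Fin 3 → ℝ) {R : Vec3} (hR : R ≠ 0) (v : Vec3) :
    fderiv ℝ (potential I) R v = gradV I R ⬝ᵥ v := by
  rw [← ((contDiffAt_potential I hR).differentiableAt (by norm_num)).lineDeriv_eq_fderiv]
  have hl := hasDerivAt_len_line hR v
  have hq := hasDerivAt_inertia_line I R v
  have h0 := len_pos hR
  have hl0 : len (R + (0 : ℝ) • v) ≠ 0 := by simpa using h0.ne'
  refine HasDerivAt.deriv ?_
  unfold potential
  have := ((((hasDerivAt_const (0 : ℝ) (1 : ℝ)).div hl hl0).neg).sub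
    ((hasDerivAt_const (0 : ℝ) (1 : ℝ)).div ((hl.pow 3).const_mul 2) (by simpa using hl0))).add
    (((hasDerivAt_const (0 : ℝ) (3 : ℝ)).div ((hl.pow 5).const_mul 2) (by simpa using hl0)).mul hq)
  refine this.congr_deriv ?_
  simp only [zero_smul, add_zero, gradV, dotProduct, inertia, Fin.sum_univ_three, Pi.pow_apply,
    Pi.div_apply]
  field_simp
  ring

theorem gradPotential_eq (I : Fin 3 → ℝ) {R : Vec3} (hR : R ≠ 0) :
    gradPotential I R = gradV I R := by
  funext i
  simp [gradPotential, fderiv_potential_apply I hR]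

theorem fderiv_hamiltonian_apply (I : Fin 3 → ℝ) {y : BodyState} (hR : y.1 ≠ 0)
    (v : BodyState) :
    fderiv ℝ (hamiltonian I) y v = (omega I y ⨯₃ y.2.2 + gradV I y.1) ⬝ᵥ v.1
      + omega I y ⬝ᵥ v.2.1 + (y.2.2 - omega I y ⨯₃ y.1) ⬝ᵥ v.2.2 := by
  have hV := (contDiffAt_potential I hR).differentiableAt (by norm_num)
  have hV' : HasDerivAt (fun t : ℝ => potential I (y.1 + t • v.1)) (gradV I y.1 ⬝ᵥ v.1) 0 := by
    rw [← fderiv_potential_apply I hR]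
    exact hV.hasFDerivAt.hasLineDerivAt v.1
  rw [← ((contDiffAt_hamiltonian I hR).differentiableAt (by norm_num)).lineDeriv_eq_fderiv]
  refine HasDerivAt.deriv ?_
  have hlin (a b : ℝ) : HasDerivAt (fun t : ℝ => a + t * b) b 0 := by
    simpa using ((hasDerivAt_id (0 : ℝ)).mul_const b).const_add a
  obtain ⟨R, Q, P⟩ := y
  obtain ⟨a, b, c⟩ := v
  have hpoly (i j k : Fin 3) : HasDerivAt (fun t : ℝ => (Q i + t * b i -
      ((R j + t * a j) * (P k + t * c k) - (R k + t * a k) * (P j + t * c j))) ^ 2 / I i)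
      (2 * ((Q i - (R j * P k - R k * P j)) / I i)
        * (b i - (a j * P k + R j * c k - a k * P j - R k * c j))) 0 := by
    refine ((((hlin _ _).sub (((hlin _ _).mul (hlin _ _)).sub
      ((hlin _ _).mul (hlin _ _)))).pow 2).div_const (I i)).congr_deriv ?_
    simp
    ring
  have hP (i : Fin 3) : HasDerivAt (fun t : ℝ => (P i + t * c i) * (P i + t * c i))
      (2 * P i * c i) 0 := by
    refine ((hlin _ _).mul (hlin _ _)).congr_deriv ?_
    simp
    ring
  have := ((((hpoly 0 1 2).add (hpoly 1 2 0)).add (hpoly 2 0 1)).add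
    (((hP 0).add (hP 1)).add (hP 2))).div_const 2 |>.add hV'
  unfold hamiltonian
  convert this using 1
  · funext t
    simp only [cross_apply, dotProduct, Fin.sum_univ_three, Prod.fst_add, Prod.snd_add,
      Prod.smul_fst, Prod.smul_snd, Pi.add_apply, Pi.smul_apply, smul_eq_mul, Matrix.cons_val]
  · simp [cross_apply, dotProduct, Fin.sum_univ_three, omega]
    ring

theorem gradR_eq (I : Fin 3 → ℝ) {y : BodyState} (hR : y.1 ≠ 0) :
    gradR I y = omega I y ⨯₃ y.2.2 + gradV I y.1 := by
  funext i
  simp [gradR, fderiv_hamiltonian_apply I hR]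

theorem gradPi_eq (I : Fin 3 → ℝ) {y : BodyState} (hR : y.1 ≠ 0) : gradPi I y = omega I y := by
  funext i
  simp [gradPi, fderiv_hamiltonian_apply I hR]

theorem gradP_eq (I : Fin 3 → ℝ) {y : BodyState} (hR : y.1 ≠ 0) :
    gradP I y = y.2.2 - omega I y ⨯₃ y.1 := by
  funext i
  simp [gradP, fderiv_hamiltonian_apply I hR]

theorem bodyField_eq (I : Fin 3 → ℝ) {y : BodyState} (hR : y.1 ≠ 0) :
    bodyField I y = (y.2.2 - omega I y ⨯₃ y.1, y.2.1 ⨯₃ omega I y,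
      -(omega I y ⨯₃ y.2.2 + gradV I y.1)) := by
  rw [bodyField, gradR_eq I hR, gradPi_eq I hR, gradP_eq I hR]

theorem isOpen_fst_ne_zero : IsOpen {y : BodyState | y.1 ≠ 0} :=
  isOpen_ne_fun continuous_fst continuous_const

theorem contDiff_omega (I : Fin 3 → ℝ) : ContDiff ℝ 2 (omega I) := by
  unfold omega
  refine contDiff_pi.2 fun i => ContDiff.div_const ?_ _
  fin_cases i <;> simp only [cross_apply, Fin.zero_eta, Fin.mk_one, Fin.reduceFinMk,
    Matrix.cons_val] <;> fun_prop

theorem _root_.ContDiffAt.crossProduct {E : Type*} [NormedAddCommGroup E] [NormedSpace ℝ E]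
    {n : WithTop ℕ∞} {f g : E → Fin 3 → ℝ} {x : E} (hf : ContDiffAt ℝ n f x)
    (hg : ContDiffAt ℝ n g x) : ContDiffAt ℝ n (fun x => f x ⨯₃ g x) x := by
  rw [contDiffAt_pi] at hf hg ⊢
  intro i
  have := hf 0; have := hf 1; have := hf 2; have := hg 0; have := hg 1; have := hg 2
  fin_cases i <;> simp only [cross_apply, Fin.zero_eta, Fin.mk_one, Fin.reduceFinMk,
    Matrix.cons_val] <;> fun_prop

theorem contDiffAt_bodyField (I : Fin 3 → ℝ) {y : BodyState} (hR : y.1 ≠ 0) :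
    ContDiffAt ℝ 2 (bodyField I) y := by
  have h : bodyField I =ᶠ[𝓝 y] fun y => (y.2.2 - omega I y ⨯₃ y.1, y.2.1 ⨯₃ omega I y,
      -(omega I y ⨯₃ y.2.2 + gradV I y.1)) :=
    (isOpen_fst_ne_zero.eventually_mem hR).mono fun x hx => bodyField_eq I hx
  have h1 : ContDiffAt ℝ 2 (fun y : BodyState => y.1) y := by fun_prop
  have h2 : ContDiffAt ℝ 2 (fun y : BodyState => y.2.1) y := by fun_prop
  have h3 : ContDiffAt ℝ 2 (fun y : BodyState => y.2.2) y := by fun_prop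
  have ho := (contDiff_omega I).contDiffAt (x := y)
  have hg : ContDiffAt ℝ 2 (fun y : BodyState => gradV I y.1) y :=
    (contDiffAt_gradV I hR).comp y contDiffAt_fst
  exact ContDiffAt.congr_of_eventuallyEq ((h3.sub (ho.crossProduct h1)).prodMk
    ((h2.crossProduct ho).prodMk ((ho.crossProduct h3).add hg).neg)) h

/-! ### Linearization of the body equations -/

/-- The squared angular velocity of the members of the orthogonal family at distance `l`. -/
def freqSq (I : Fin 3 → ℝ) (l : ℝ) : ℝ := (2 * l ^ 2 + 3 - 9 * I 1) / (2 * l ^ 5)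

/-- The eigenvalues of the Hessian of the potential at the point `(0, ±l, 0)`. -/
def hessV (I : Fin 3 → ℝ) (l : ℝ) : Vec3 :=
  ![freqSq I l + 3 * (I 0 - I 1) / l ^ 5, -(2 * l ^ 2 + 6 - 18 * I 1) / l ^ 5,
    freqSq I l + 3 * (I 2 - I 1) / l ^ 5]

theorem axis_ne_zero {r : ℝ} (hr : r ≠ 0) : (![0, r, 0] : Vec3) ≠ 0 := fun h =>
  hr (by simpa using congrFun h 1)

theorem len_axis (r : ℝ) : len ![0, r, 0] = |r| := by
  simp [len, dotProduct, Fin.sum_univ_three, Real.sqrt_mul_self_eq_abs]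

theorem freqSq_pos {I : Fin 3 → ℝ} (hI : I 1 < 1 / 3) {l : ℝ} (hl : 0 < l) : 0 < freqSq I l :=
  div_pos (by nlinarith [sq_nonneg l]) (by positivity)

theorem gradV_axis (I : Fin 3 → ℝ) {r : ℝ} (hr : r ≠ 0) :
    gradV I ![0, r, 0] = freqSq I |r| • ![0, r, 0] := by
  have hl : 0 < |r| := abs_pos.2 hr
  have h2 : r ^ 2 = |r| ^ 2 := (sq_abs r).symm
  funext i
  fin_cases i
  · simp [gradV]
  · simp [gradV, len_axis, dotProduct, inertia, Fin.sum_univ_three, freqSq]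
    rw [show r * (I 1 * r) = I 1 * r ^ 2 by ring, h2]
    field_simp
    ring
  · simp [gradV]

theorem fderiv_gradV_axis (I : Fin 3 → ℝ) {r : ℝ} (hr : r ≠ 0) (v : Vec3) :
    fderiv ℝ (gradV I) ![0, r, 0] v = fun i => hessV I |r| i * v i := by
  have hR := axis_ne_zero hr
  have hl : 0 < |r| := abs_pos.2 hr
  have h2 : r ^ 2 = |r| ^ 2 := (sq_abs r).symm
  rw [← ((contDiffAt_gradV I hR).differentiableAt (by norm_num)).lineDeriv_eq_fderiv]
  refine HasDerivAt.deriv (hasDerivAt_pi.2 fun i => ?_)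
  have hd := hasDerivAt_len_line hR v
  have hq := hasDerivAt_inertia_line I ![0, r, 0] v
  have h0 := len_pos hR
  have hl0 : len (![0, r, 0] + (0 : ℝ) • v) ≠ 0 := by simpa using h0.ne'
  have hx : HasDerivAt (fun t : ℝ => (![0, r, 0] + t • v) i) (v i) 0 := by
    simpa using ((hasDerivAt_id (0 : ℝ)).mul_const (v i)).const_add ((![0, r, 0] : Vec3) i)
  have hc (c : ℝ) := hasDerivAt_const (0 : ℝ) c
  have := hx.mul (((((hc 1).div (hd.pow 3) (by simpa using hl0)).add
    ((hc 3).div ((hd.pow 5).const_mul 2) (by simpa using hl0))).sub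
    (((hc 15).div ((hd.pow 7).const_mul 2) (by simpa using hl0)).mul hq)).add
    ((hc (3 * I i)).div (hd.pow 5) (by simpa using hl0)))
  refine this.congr_deriv ?_
  simp only [zero_smul, add_zero, Pi.pow_apply, Pi.div_apply, Pi.add_apply, Pi.mul_apply,
    Pi.sub_apply, len_axis, hessV, freqSq, dotProduct, inertia, Fin.sum_univ_three]
  generalize |r| = l at *
  fin_cases i
  · simp
    rw [show r * (I 1 * r) = I 1 * r ^ 2 by ring, h2]
    field_simp
    ring
  · simp
    field_simp
    have h4 : r ^ 4 = l ^ 4 := by rw [show r ^ 4 = (r ^ 2) ^ 2 by ring, h2]; ring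
    ring_nf
    rw [h4, h2]
    ring
  · simp
    rw [show r * (I 1 * r) = I 1 * r ^ 2 by ring, h2]
    field_simp
    ring

theorem _root_.HasDerivAt.crossProduct {f g : ℝ → Fin 3 → ℝ} {f' g' : Fin 3 → ℝ} {t : ℝ}
    (hf : HasDerivAt f f' t) (hg : HasDerivAt g g' t) :
    HasDerivAt (fun s => f s ⨯₃ g s) (f' ⨯₃ g t + f t ⨯₃ g') t := by
  rw [hasDerivAt_pi] at hf hg ⊢
  intro i
  fin_cases i
  · exact (((hf 1).mul (hg 2)).sub ((hf 2).mul (hg 1))).congr_deriv (by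
      simp [cross_apply]; ring)
  · exact (((hf 2).mul (hg 0)).sub ((hf 0).mul (hg 2))).congr_deriv (by
      simp [cross_apply]; ring)
  · exact (((hf 0).mul (hg 1)).sub ((hf 1).mul (hg 0))).congr_deriv (by
      simp [cross_apply]; ring)

theorem _root_.HasDerivAt.dotProduct {f g : ℝ → Fin 3 → ℝ} {f' g' : Fin 3 → ℝ} {t : ℝ}
    (hf : HasDerivAt f f' t) (hg : HasDerivAt g g' t) :
    HasDerivAt (fun s => f s ⬝ᵥ g s) (f' ⬝ᵥ g t + f t ⬝ᵥ g') t := by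
  rw [hasDerivAt_pi] at hf hg
  have := (((hf 0).mul (hg 0)).add ((hf 1).mul (hg 1))).add ((hf 2).mul (hg 2))
  refine (this.congr_deriv ?_).congr_of_eventuallyEq (.of_forall fun s => ?_)
  · simp [_root_.dotProduct, Fin.sum_univ_three]
    ring
  · simp [_root_.dotProduct, Fin.sum_univ_three]

/-- The derivative of the body angular velocity at `y` in the direction `v`. -/
def linOmega (I : Fin 3 → ℝ) (y v : BodyState) : Vec3 :=
  fun i => (v.2.1 i - (v.1 ⨯₃ y.2.2 + y.1 ⨯₃ v.2.2) i) / I i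

theorem hasDerivAt_omega (I : Fin 3 → ℝ) {c : ℝ → BodyState} {v : BodyState} {t : ℝ}
    (hc : HasDerivAt c v t) :
    HasDerivAt (fun s => omega I (c s)) (linOmega I (c t) v) t := by
  have h1 : HasDerivAt (fun s => (c s).1) v.1 t := hc.fst
  have h2 : HasDerivAt (fun s => (c s).2.1) v.2.1 t := hc.snd.fst
  have h3 : HasDerivAt (fun s => (c s).2.2) v.2.2 t := hc.snd.snd
  have h4 := h1.crossProduct h3
  rw [hasDerivAt_pi] at h2 h4 ⊢
  exact fun i => ((h2 i).sub (h4 i)).div_const (I i)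

theorem fderiv_bodyField_apply (I : Fin 3 → ℝ) {y : BodyState} (hR : y.1 ≠ 0) (v : BodyState) :
    fderiv ℝ (bodyField I) y v =
      (v.2.2 - (linOmega I y v ⨯₃ y.1 + omega I y ⨯₃ v.1),
        v.2.1 ⨯₃ omega I y + y.2.1 ⨯₃ linOmega I y v,
        -(linOmega I y v ⨯₃ y.2.2 + omega I y ⨯₃ v.2.2 + fderiv ℝ (gradV I) y.1 v.1)) := by
  rw [← ((contDiffAt_bodyField I hR).differentiableAt (by norm_num)).lineDeriv_eq_fderiv]
  have hc : HasDerivAt (fun t : ℝ => y + t • v) v 0 := by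
    simpa using ((hasDerivAt_id (0 : ℝ)).smul_const v).const_add y
  have h1 : HasDerivAt (fun t : ℝ => (y + t • v).1) v.1 0 := hc.fst
  have h2 : HasDerivAt (fun t : ℝ => (y + t • v).2.1) v.2.1 0 := hc.snd.fst
  have h3 : HasDerivAt (fun t : ℝ => (y + t • v).2.2) v.2.2 0 := hc.snd.snd
  have ho := hasDerivAt_omega I hc
  have hg : HasDerivAt (fun t : ℝ => gradV I (y + t • v).1) (fderiv ℝ (gradV I) y.1 v.1) 0 :=
    ((contDiffAt_gradV I hR).differentiableAt (by norm_num)).hasFDerivAt.hasLineDerivAt v.1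
  have h0 : (fun t : ℝ => bodyField I (y + t • v)) =ᶠ[𝓝 0] fun t =>
      ((y + t • v).2.2 - omega I (y + t • v) ⨯₃ (y + t • v).1,
        (y + t • v).2.1 ⨯₃ omega I (y + t • v),
        -(omega I (y + t • v) ⨯₃ (y + t • v).2.2 + gradV I (y + t • v).1)) := by
    have := hc.continuousAt.eventually_mem (isOpen_fst_ne_zero.mem_nhds (by simpa using hR))
    exact this.mono fun t ht => bodyField_eq I ht
  refine HasDerivAt.deriv (HasDerivAt.congr_of_eventuallyEq ?_ h0)
  refine ((h3.sub (ho.crossProduct h1)).prodMk ((h2.crossProduct ho).prodMk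
    ((ho.crossProduct h3).add hg).neg)).congr_deriv ?_
  simp

/-! ### Relative equilibria -/

theorem transpose_mul_hat_mul (M : Matrix (Fin 3) (Fin 3) ℝ) (u : Vec3) :
    Mᵀ * hat (M *ᵥ u) * M = M.det • hat u := by
  ext i j
  fin_cases i <;> fin_cases j <;>
    simp [hat, Matrix.mul_apply, Matrix.mulVec, dotProduct, Fin.sum_univ_three,
      Matrix.det_fin_three] <;> ring

theorem hat_injective : Function.Injective hat := by
  intro u v h
  funext i
  fin_cases i
  · simpa [hat] using congrFun (congrFun h 2) 1
  · simpa [hat] using congrFun (congrFun h 0) 2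
  · simpa [hat] using congrFun (congrFun h 1) 0

theorem SO3.mul_transpose (B : SO3) : B.1 * B.1ᵀ = 1 :=
  (Matrix.mem_orthogonalGroup_iff _ _).1 (Matrix.mem_specialOrthogonalGroup_iff.1 B.2).1

theorem SO3.transpose_mul (B : SO3) : B.1ᵀ * B.1 = 1 :=
  mul_eq_one_comm.1 (SO3.mul_transpose B)

theorem SO3.det_eq_one (B : SO3) : B.1.det = 1 :=
  (Matrix.mem_specialOrthogonalGroup_iff.1 B.2).2

theorem SO3.mem_iff {M : Matrix (Fin 3) (Fin 3) ℝ} :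
    M ∈ Matrix.specialOrthogonalGroup (Fin 3) ℝ ↔ M * Mᵀ = 1 ∧ M.det = 1 := by
  rw [Matrix.mem_specialOrthogonalGroup_iff, Matrix.mem_orthogonalGroup_iff]

theorem SO3.transpose_mulVec_mulVec (B : SO3) (u : Vec3) : B.1ᵀ *ᵥ (B.1 *ᵥ u) = u := by
  rw [Matrix.mulVec_mulVec, SO3.transpose_mul B, Matrix.one_mulVec]

theorem SO3.hat_mulVec_mul (B : SO3) (u : Vec3) : hat (B.1 *ᵥ u) * B.1 = B.1 * hat u := by
  have h := transpose_mul_hat_mul B.1 u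
  rw [SO3.det_eq_one B, one_smul] at h
  rw [← h, ← Matrix.mul_assoc, ← Matrix.mul_assoc, (SO3.mul_transpose B), Matrix.one_mul]

theorem hat_transpose (u : Vec3) : (hat u)ᵀ = -hat u := by
  ext i j
  fin_cases i <;> fin_cases j <;> simp [hat]

theorem exp_hat_mem (ξ : Vec3) (t : ℝ) :
    NormedSpace.exp (t • hat ξ) ∈ Matrix.specialOrthogonalGroup (Fin 3) ℝ := by
  have horth (s : ℝ) : NormedSpace.exp (s • hat ξ) * (NormedSpace.exp (s • hat ξ))ᵀ = 1 := by
    rw [← Matrix.exp_transpose, Matrix.transpose_smul, hat_transpose, smul_neg, Matrix.exp_neg]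
    exact Matrix.mul_nonsing_inv _ ((Matrix.isUnit_iff_isUnit_det _).1 (Matrix.isUnit_exp _))
  refine SO3.mem_iff.2 ⟨horth t, ?_⟩
  -- the determinant is a square, since the exponential is
  have hsq : NormedSpace.exp (t • hat ξ) =
      NormedSpace.exp ((t / 2) • hat ξ) * NormedSpace.exp ((t / 2) • hat ξ) := by
    rw [← Matrix.exp_add_of_commute _ _ (Commute.refl _), ← add_smul, add_halves]
  have h1 := congrArg Matrix.det (horth (t / 2))
  rw [Matrix.det_mul, Matrix.det_transpose, Matrix.det_one] at h1
  rw [hsq, Matrix.det_mul, h1]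

theorem hasDerivAt_exp_smul_mul (A B : Matrix (Fin 3) (Fin 3) ℝ) (t : ℝ) (i j : Fin 3) :
    HasDerivAt (fun s : ℝ => (NormedSpace.exp (s • A) * B) i j)
      ((NormedSpace.exp (t • A) * A * B) i j) t := by
  let _ : NormedRing (Matrix (Fin 3) (Fin 3) ℝ) := Matrix.linftyOpNormedRing
  let _ : NormedAlgebra ℝ (Matrix (Fin 3) (Fin 3) ℝ) := Matrix.linftyOpNormedAlgebra
  have h : HasDerivAt (fun s : ℝ => NormedSpace.exp (s • A)) (NormedSpace.exp (t • A) * A) t :=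
    hasDerivAt_exp_smul_const A t
  have h2 := h.mul_const B
  have h3 : HasFDerivAt (fun M : Matrix (Fin 3) (Fin 3) ℝ => M i j)
      (LinearMap.toContinuousLinearMap (Matrix.entryLinearMap ℝ ℝ i j))
      (NormedSpace.exp (t • A) * B) :=
    (LinearMap.toContinuousLinearMap (Matrix.entryLinearMap ℝ ℝ i j)).hasFDerivAt
  exact h3.comp_hasDerivAt t h2

/-- Relative equilibria are the zeros of the reduced vector field, and the angular velocity in space
is the image of the body angular velocity. -/
theorem isRelEq_iff {I : Fin 3 → ℝ} {z : Phase} {ξ : Vec3} :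
    IsRelEq I z ξ ↔ z.2.1 ≠ 0 ∧ bodyField I z.2 = 0 ∧ ξ = z.1.1 *ᵥ omega I z.2 := by
  constructor
  · rintro ⟨γ, hγ, h⟩
    have hz : (fun s => (γ s).2) = fun _ => z.2 := funext fun s => (h s).2
    obtain ⟨h0, h1, h2⟩ := hγ 0
    rw [(h 0).2] at h0 h1 h2
    refine ⟨h0, ?_, ?_⟩
    · rw [hz] at h1
      exact h1.unique (hasDerivAt_const _ _)
    · have h3 : hat ξ * z.1.1 = z.1.1 * hat (omega I z.2) := by
        ext i j
        have h4 := h2 i j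
        have h5 : (fun s => (γ s).1.1 i j) = fun s : ℝ =>
            (NormedSpace.exp (s • hat ξ) * z.1.1) i j := funext fun s => by rw [(h s).1]
        rw [h5, (h 0).1, gradPi_eq I h0] at h4
        simpa using (hasDerivAt_exp_smul_mul (hat ξ) z.1.1 0 i j).unique h4
      rw [← SO3.hat_mulVec_mul] at h3
      have h4 := congrArg (· * z.1.1ᵀ) h3
      simp only [Matrix.mul_assoc, SO3.mul_transpose, Matrix.mul_one] at h4
      exact hat_injective h4
  · rintro ⟨h0, h1, h2⟩
    refine ⟨fun t => (⟨NormedSpace.exp (t • hat ξ), exp_hat_mem ξ t⟩ * z.1, z.2),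
      fun t => ⟨h0, ?_, fun i j => ?_⟩, fun t => ⟨rfl, rfl⟩⟩
    · simpa [h1] using hasDerivAt_const t z.2
    · refine (hasDerivAt_exp_smul_mul (hat ξ) z.1.1 t i j).congr_deriv ?_
      simp only [gradPi_eq I h0]
      rw [Matrix.mul_assoc, h2, SO3.hat_mulVec_mul, ← Matrix.mul_assoc]
      rfl

theorem bodyField_eq_zero_iff {I : Fin 3 → ℝ} {y : BodyState} (hR : y.1 ≠ 0) :
    bodyField I y = 0 ↔ y.2.2 = omega I y ⨯₃ y.1 ∧ y.2.1 ⨯₃ omega I y = 0 ∧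
      omega I y ⨯₃ y.2.2 + gradV I y.1 = 0 := by
  rw [bodyField_eq I hR, Prod.ext_iff, Prod.ext_iff]
  simp only [Prod.fst_zero, Prod.snd_zero, neg_eq_zero, sub_eq_zero]

/-- The body state of an orthogonal relative equilibrium at `(0, r, 0)` with body angular velocity
`(w, 0, 0)`. -/
def baseState (I : Fin 3 → ℝ) (r w : ℝ) : BodyState :=
  (![0, r, 0], ![(I 0 + r ^ 2) * w, 0, 0], ![0, 0, w * r])

theorem omega_baseState {I : Fin 3 → ℝ} (hI : ∀ i, I i ≠ 0) (r w : ℝ) :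
    omega I (baseState I r w) = ![w, 0, 0] := by
  have := hI 0
  funext i
  fin_cases i <;> simp [omega, baseState, cross_apply]
  field_simp
  ring

theorem momentum_eq_of_omega {I : Fin 3 → ℝ} (hI : ∀ i, I i ≠ 0) (y : BodyState) (i : Fin 3) :
    y.2.1 i = I i * omega I y i + (y.1 ⨯₃ y.2.2) i := by
  have := hI i
  simp only [omega]
  field_simp
  ring

theorem bodyField_baseState {I : Fin 3 → ℝ} (hI : ∀ i, I i ≠ 0) {r w : ℝ} (hr : r ≠ 0)
    (hw : w ^ 2 = freqSq I |r|) : bodyField I (baseState I r w) = 0 := by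
  rw [bodyField_eq_zero_iff (axis_ne_zero hr), omega_baseState hI]
  simp only [baseState]
  refine ⟨?_, ?_, ?_⟩
  · simp [cross_apply]
  · simp [cross_apply]
  · rw [gradV_axis I hr, ← hw]
    funext i
    fin_cases i <;> simp [cross_apply]
    ring

/-- The members of the family, up to their attitude, which is arbitrary. -/
theorem mem_orthFamily_iff {I : Fin 3 → ℝ} (hI : ∀ i, I i ≠ 0) {z : Phase} :
    z ∈ orthFamily I ↔
      ∃ r w : ℝ, r ≠ 0 ∧ w ^ 2 = freqSq I |r| ∧ z.2 = baseState I r w := by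
  constructor
  · rintro ⟨ξ, hξ, -, ⟨hR0, hR2⟩, hx1, hx2⟩
    obtain ⟨h0, h1, rfl⟩ := isRelEq_iff.1 hξ
    rw [SO3.transpose_mulVec_mulVec] at hx1 hx2
    obtain ⟨B, R, Q, P⟩ := z
    dsimp only at h0 h1 hx1 hx2 hR0 hR2 ⊢
    obtain ⟨r, rfl⟩ : ∃ r, R = ![0, r, 0] :=
      ⟨R 1, by funext i; fin_cases i <;> simp [hR0, hR2]⟩
    obtain ⟨w, hw⟩ : ∃ w, omega I (![0, r, 0], Q, P) = ![w, 0, 0] :=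
      ⟨omega I (![0, r, 0], Q, P) 0, by funext i; fin_cases i <;> simp [hx1, hx2]⟩
    have hr0 : r ≠ 0 := by
      rintro rfl
      exact h0 (by funext i; fin_cases i <;> simp)
    obtain ⟨e1, -, e3⟩ := (bodyField_eq_zero_iff h0).1 h1
    have hQ := momentum_eq_of_omega hI (![0, r, 0], Q, P)
    rw [hw] at e1 e3 hQ
    dsimp only at e1 e3 hQ
    have hP : P = ![0, 0, w * r] := by
      rw [e1]
      simp [cross_apply]
    subst hP
    refine ⟨r, w, hr0, ?_, ?_⟩
    · have := congrFun e3 1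
      rw [gradV_axis I hr0] at this
      simp [cross_apply] at this
      refine mul_right_cancel₀ hr0 ?_
      linarith
    · simp only [baseState, Prod.mk.injEq, true_and, and_true]
      funext i
      rw [hQ]
      fin_cases i <;> simp [cross_apply]
      ring
  · rintro ⟨r, w, hr, hw, hz⟩
    refine ⟨z.1.1 *ᵥ omega I z.2, isRelEq_iff.2 ⟨?_, ?_, rfl⟩, ?_, ?_, ?_⟩
    · rw [hz]; exact axis_ne_zero hr
    · rw [hz]; exact bodyField_baseState hI hr hw
    · rw [IsOrthogonal, Matrix.dotProduct_mulVec, ← Matrix.mulVec_transpose,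
        SO3.transpose_mulVec_mulVec, hz, omega_baseState hI]
      simp [baseState, dotProduct, Fin.sum_univ_three]
    · rw [hz]; simp [baseState]
    · rw [SO3.transpose_mulVec_mulVec, hz, omega_baseState hI]
      simp

theorem len_baseState (I : Fin 3 → ℝ) (r w : ℝ) : len (baseState I r w).1 = |r| := len_axis r

/-- The members of the family at a given distance form one orbit of the symmetry group: position and
angular velocity are determined up to two signs, which the discrete symmetries change
independently. -/
theorem orthFamily_orbit {I : Fin 3 → ℝ} (hI : ∀ i, I i ≠ 0) (hI1 : I 1 < 1 / 3) {R : ℝ}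
    (hR : 0 < R) : ∃ z, ∀ x : Phase, (x ∈ orthFamily I ∧ len x.2.1 = R) ↔ ∃ g, x = act g z := by
  have hf := freqSq_pos hI1 hR
  refine ⟨(1, baseState I R (√(freqSq I R))), fun x => ?_⟩
  set w := √(freqSq I R)
  have hw : w ^ 2 = freqSq I R := Real.sq_sqrt hf.le
  -- the discrete symmetries act on the signs of `r` and `w`
  have hact (ε : Signs) (M : SO3) : (act (M, ε) (1, baseState I R w)).2 =
      baseState I (((ε 1 : ℤ) : ℝ) * R) (((ε 1 * ε 2 : ℤˣ) : ℤ) * w) := by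
    have h0 := Int.units_eq_one_or (ε 0)
    have h1 := Int.units_eq_one_or (ε 1)
    have h2 := Int.units_eq_one_or (ε 2)
    simp only [act, baseState, Fin.prod_univ_three]
    refine Prod.ext ?_ (Prod.ext ?_ ?_) <;> funext i <;> fin_cases i <;>
      rcases h0 with h0 | h0 <;> rcases h1 with h1 | h1 <;> rcases h2 with h2 | h2 <;>
      simp [h0, h1, h2, signAct]
  constructor
  · rintro ⟨hx, hlen⟩
    obtain ⟨r, v, hr, hv, hx2⟩ := (mem_orthFamily_iff hI).1 hx
    rw [hx2, len_baseState] at hlen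
    rw [hlen, ← hw, sq_eq_sq_iff_eq_or_eq_neg] at hv
    have h1 : ∃ e : ℤˣ, r = ((e : ℤ) : ℝ) * R := by
      rcases abs_eq hR.le |>.1 hlen with h | h
      · exact ⟨1, by simp [h]⟩
      · exact ⟨-1, by simp [h]⟩
    have h2 : ∃ e : ℤˣ, v = ((e : ℤ) : ℝ) * w := by
      rcases hv with h | h
      · exact ⟨1, by simp [h]⟩
      · exact ⟨-1, by simp [h]⟩
    obtain ⟨e, rfl⟩ := h1
    obtain ⟨e', rfl⟩ := h2
    refine ⟨(x.1 * (signRot ![1, e, e * e'])⁻¹, ![1, e, e * e']), Prod.ext ?_ ?_⟩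
    · simp [act]
    · rw [hact, hx2]
      simp [← mul_assoc, Int.units_mul_self]
  · rintro ⟨⟨M, ε⟩, rfl⟩
    have h1 := Int.units_eq_one_or (ε 1)
    have h2 := Int.units_eq_one_or (ε 2)
    have habs : |((ε 1 : ℤ) : ℝ) * R| = R := by
      rcases h1 with h1 | h1 <;> simp [h1, abs_of_pos hR]
    refine ⟨(mem_orthFamily_iff hI).2 ⟨_, _, ?_, ?_, hact ε M⟩, ?_⟩
    · rcases h1 with h1 | h1 <;> simp [h1, hR.ne']
    · rw [habs, ← hw]
      rcases h1 with h1 | h1 <;> rcases h2 with h2 | h2 <;> simp [h1, h2]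
    · rw [hact, len_baseState, habs]

/-! ### Global solutions -/

/-- A bounded, globally Lipschitz vector field on a Banach space is complete. -/
theorem exists_global_solution {E : Type*} [NormedAddCommGroup E] [NormedSpace ℝ E]
    [CompleteSpace E] {f : E → E} {K L : NNReal} (hK : LipschitzWith K f) (hL : ∀ x, ‖f x‖ ≤ L)
    (x : E) : ∃ α : ℝ → E, α 0 = x ∧ ∀ t, HasDerivAt α (f (α t)) t := by
  have hloc (n : ℕ) : ∃ α : ℝ → E, α 0 = x ∧
      ∀ t ∈ Set.Ioo (-(n : ℝ)) n, HasDerivAt α (f (α t)) t := by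
    have hn : (0 : ℝ) ∈ Set.Icc (-(n : ℝ)) n := by simp
    obtain ⟨α, h0, h⟩ := (IsPicardLindelof.of_time_independent (f := f) (t₀ := ⟨0, hn⟩) (x₀ := x)
      (a := L * n) (r := 0) (L := L) (K := K) (fun x _ => hL x) hK.lipschitzOnWith
      (by simp)).exists_eq_forall_mem_Icc_hasDerivWithinAt₀
    exact ⟨α, h0, fun t ht => (h t (Set.Ioo_subset_Icc_self ht)).hasDerivAt (Icc_mem_nhds ht.1 ht.2)⟩
  choose α h0 hα using hloc
  have hagree {m n : ℕ} (hm : 0 < m) (hmn : m ≤ n) : Set.EqOn (α m) (α n) (Set.Ioo (-(m : ℝ)) m) := by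
    have hm' : (0 : ℝ) < m := by exact_mod_cast hm
    have hmn' : (m : ℝ) ≤ n := by exact_mod_cast hmn
    refine ODE_solution_unique_of_mem_Ioo (v := fun _ => f) (s := fun _ => Set.univ) (K := K)
      (t₀ := 0) (fun _ _ => hK.lipschitzOnWith) (by simpa using hm')
      (fun t ht => ⟨hα m t ht, trivial⟩) (fun t ht => ⟨hα n t ?_, trivial⟩) ((h0 m).trans (h0 n).symm)
    exact ⟨by linarith [ht.1], by linarith [ht.2]⟩
  have hfl (t : ℝ) : |t| < (⌊|t|⌋₊ + 1 : ℕ) := by exact_mod_cast Nat.lt_floor_add_one |t|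
  -- near every time the glued curve coincides with one of the local solutions
  have heq (t : ℝ) (n : ℕ) (ht : |t| < n) : α (⌊|t|⌋₊ + 1) t = α n t := by
    have hle : ⌊|t|⌋₊ + 1 ≤ n := Nat.succ_le_of_lt ((Nat.floor_lt (abs_nonneg t)).2 ht)
    exact hagree (Nat.succ_pos _) hle (abs_lt.1 (hfl t))
  refine ⟨fun t => α (⌊|t|⌋₊ + 1) t, h0 _, fun t => ?_⟩
  have h1 := hα (⌊|t|⌋₊ + 1) t (abs_lt.1 (hfl t))
  refine h1.congr_of_eventuallyEq ?_
  filter_upwards [(continuous_abs.tendsto t).eventually (gt_mem_nhds (hfl t))] with s hs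
  exact heq s _ hs

/-- The vector field on `BodyState × Mat₃` of the Hamiltonian system, with the attitude regarded as
an arbitrary matrix. -/
def fullField (I : Fin 3 → ℝ) (p : BodyState × (Fin 3 → Fin 3 → ℝ)) :
    BodyState × (Fin 3 → Fin 3 → ℝ) :=
  (bodyField I p.1, Matrix.of p.2 * hat (omega I p.1))

theorem contDiffAt_fullField (I : Fin 3 → ℝ) {p : BodyState × (Fin 3 → Fin 3 → ℝ)}
    (hR : p.1.1 ≠ 0) : ContDiffAt ℝ 1 (fullField I) p := by
  have h1 : ContDiffAt ℝ 1 (fun p : BodyState × (Fin 3 → Fin 3 → ℝ) => bodyField I p.1) p :=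
    ((contDiffAt_bodyField I hR).of_le (by norm_num)).comp p contDiffAt_fst
  have h2 : ContDiffAt ℝ 1 (fun p : BodyState × (Fin 3 → Fin 3 → ℝ) => omega I p.1) p :=
    (((contDiff_omega I).of_le (by norm_num)).contDiffAt).comp p contDiffAt_fst
  rw [contDiffAt_pi] at h2
  have := h2 0; have := h2 1; have := h2 2
  refine h1.prodMk (contDiffAt_pi.2 fun i => contDiffAt_pi.2 fun j => ?_)
  fin_cases j <;> simp [Matrix.mul_apply, Fin.sum_univ_three, hat] <;> fun_prop

theorem SO3.abs_apply_le (B : Matrix (Fin 3) (Fin 3) ℝ) (hB : B * Bᵀ = 1) (i j : Fin 3) :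
    |B i j| ≤ 1 := by
  have : B ∈ Matrix.unitaryGroup (Fin 3) ℝ := (Matrix.mem_orthogonalGroup_iff _ _).2 hB
  exact entry_norm_bound_of_unitary this i j

/-- Multiplying the Hamiltonian vector field by a cutoff makes it complete; the attitude remains a
rotation. -/
theorem exists_cutoff_flow (I : Fin 3 → ℝ) (y₀ : BodyState) {ρ : ℝ} (hρ : 0 < ρ)
    (hball : ∀ y ∈ Metric.closedBall y₀ ρ, y.1 ≠ 0) (x : Phase) :
    ∃ γ : ℝ → Phase, γ 0 = x ∧ ∀ t, ∃ c : ℝ, ((γ t).2 ∈ Metric.closedBall y₀ (ρ / 2) → c = 1) ∧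
      HasDerivAt (fun s => (γ s).2) (c • bodyField I (γ t).2) t ∧
      ∀ i j, HasDerivAt (fun s => (γ s).1.1 i j)
        (c * ((γ t).1.1 * hat (omega I (γ t).2)) i j) t := by
  let χ : ContDiffBump y₀ := ⟨ρ / 2, ρ, by linarith, by linarith⟩
  let φ : ContDiffBump (0 : Fin 3 → Fin 3 → ℝ) := ⟨1, 2, by norm_num, by norm_num⟩
  let ψ : BodyState × (Fin 3 → Fin 3 → ℝ) → ℝ := fun p => χ p.1 * φ p.2
  have hψ : ContDiff ℝ 1 ψ := (χ.contDiff.comp contDiff_fst).mul (φ.contDiff.comp contDiff_snd)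
  have hsupp : tsupport ψ ⊆ Metric.closedBall y₀ ρ ×ˢ Metric.closedBall 0 2 := by
    refine closure_minimal (fun p hp => ?_) (Metric.isClosed_closedBall.prod
      Metric.isClosed_closedBall)
    have h1 : p.1 ∈ Function.support χ := left_ne_zero_of_mul hp
    have h2 : p.2 ∈ Function.support φ := right_ne_zero_of_mul hp
    rw [ContDiffBump.support_eq] at h1 h2
    exact ⟨Metric.ball_subset_closedBall h1, Metric.ball_subset_closedBall h2⟩
  have hcs : HasCompactSupport ψ := ((isCompact_closedBall _ _).prod
    (isCompact_closedBall _ _)).of_isClosed_subset (isClosed_tsupport _) hsupp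
  let F : BodyState × (Fin 3 → Fin 3 → ℝ) → BodyState × (Fin 3 → Fin 3 → ℝ) :=
    fun p => ψ p • fullField I p
  have hF : ContDiff ℝ 1 F := by
    refine contDiff_iff_contDiffAt.2 fun p => ?_
    by_cases hp : p ∈ tsupport ψ
    · exact hψ.contDiffAt.smul (contDiffAt_fullField I (hball _ (hsupp hp).1))
    · refine (contDiffAt_const (c := 0)).congr_of_eventuallyEq ?_
      filter_upwards [notMem_tsupport_iff_eventuallyEq.1 hp] with q hq
      simp [F, hq]
  have hFs : HasCompactSupport F := hcs.smul_right
  obtain ⟨K, hK⟩ := hF.lipschitzWith_of_hasCompactSupport hFs one_ne_zero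
  obtain ⟨L, hL⟩ := hFs.exists_bound_of_continuous hF.continuous
  obtain ⟨α, hα0, hα⟩ := exists_global_solution (L := L.toNNReal) hK
    (fun p => (hL p).trans (Real.le_coe_toNNReal L)) (x.2, x.1.1)
  have hM (t : ℝ) (i j : Fin 3) : HasDerivAt (fun s => (α s).2 i j)
      (ψ (α t) * (Matrix.of (α t).2 * hat (omega I (α t).1)) i j) t :=
    hasDerivAt_pi.1 (hasDerivAt_pi.1 (hα t).snd i) j
  -- `M Mᵀ` is constant along the solution because `hat` takes skew-symmetric values
  have horth (t : ℝ) : Matrix.of (α t).2 * (Matrix.of (α t).2)ᵀ = 1 := by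
    ext i k
    have hd (t : ℝ) : HasDerivAt (fun s => (Matrix.of (α s).2 * (Matrix.of (α s).2)ᵀ) i k) 0 t := by
      have := (((hM t i 0).mul (hM t k 0)).add ((hM t i 1).mul (hM t k 1))).add
        ((hM t i 2).mul (hM t k 2))
      refine (this.congr_deriv ?_).congr_of_eventuallyEq (.of_forall fun s => ?_)
      · simp [Matrix.mul_apply, Fin.sum_univ_three, hat]
        ring
      · simp [Matrix.mul_apply, Fin.sum_univ_three]
    rw [is_const_of_deriv_eq_zero (fun t => (hd t).differentiableAt) (fun t => (hd t).deriv) t 0,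
      hα0]
    exact congrFun (congrFun (SO3.mul_transpose x.1) i) k
  have hdet (t : ℝ) : (Matrix.of (α t).2).det = 1 := by
    have hcont : Continuous fun t => (Matrix.of (α t).2).det := by
      refine Continuous.matrix_det (continuous_matrix fun i j => ?_)
      exact continuous_iff_continuousAt.2 fun t => (hM t i j).continuousAt
    have hsq (t : ℝ) : (Matrix.of (α t).2).det ^ 2 = 1 := by
      have := congrArg Matrix.det (horth t)
      rwa [Matrix.det_mul, Matrix.det_transpose, Matrix.det_one, ← sq] at this
    have h0 : (Matrix.of (α 0).2).det = 1 := by rw [hα0]; exact SO3.det_eq_one x.1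
    refine (isPreconnected_univ.eq_of_sq_eq hcont.continuousOn continuousOn_const
      (fun s _ => ?_) (fun _ => one_ne_zero) (Set.mem_univ 0) h0) (Set.mem_univ t)
    simpa using hsq s
  refine ⟨fun t => (⟨Matrix.of (α t).2, SO3.mem_iff.2 ⟨horth t, hdet t⟩⟩, (α t).1), ?_, fun t =>
    ⟨ψ (α t), fun ht => ?_, (hα t).fst, fun i j => hM t i j⟩⟩
  · refine Prod.ext (Subtype.ext ?_) ?_
    · simp [hα0]
      rfl
    · simp [hα0]
  · have h1 : χ (α t).1 = 1 := χ.one_of_mem_closedBall ht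
    have h2 : φ (α t).2 = 1 := by
      refine φ.one_of_mem_closedBall ?_
      rw [mem_closedBall_zero_iff, pi_norm_le_iff_of_nonneg zero_le_one]
      refine fun i => (pi_norm_le_iff_of_nonneg zero_le_one).2 fun j => ?_
      exact SO3.abs_apply_le _ (horth t) i j
    simp [ψ, h1, h2]

/-! ### Stability by conserved quantities -/

/-- A curve that starts inside a ball cannot leave it if a quantity conserved inside the ball exceeds
its initial value on the boundary sphere. -/
theorem dist_lt_of_conserved {X : Type*} [PseudoMetricSpace X] {y : ℝ → X} (hy : Continuous y)
    {f : X → ℝ} {y₀ : X} {δ : ℝ}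
    (hf : ∀ t, dist (y t) y₀ ≤ δ → HasDerivAt (fun s => f (y s)) 0 t)
    (hδ : ∀ x, dist x y₀ = δ → f (y 0) < f x) (h0 : dist (y 0) y₀ < δ) (t : ℝ) :
    dist (y t) y₀ < δ := by
  have key {y : ℝ → X} (hy : Continuous y)
      (hf : ∀ t, dist (y t) y₀ ≤ δ → HasDerivAt (fun s => f (y s)) 0 t)
      (hδ : ∀ x, dist x y₀ = δ → f (y 0) < f x) (h0 : dist (y 0) y₀ < δ) {t : ℝ} (ht : 0 ≤ t) :
      dist (y t) y₀ < δ := by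
    by_contra! hcon
    have hd : Continuous fun s => dist (y s) y₀ := hy.dist continuous_const
    -- the first exit time
    let S : Set ℝ := Set.Icc 0 t ∩ {s | δ ≤ dist (y s) y₀}
    have hS : IsCompact S := isCompact_Icc.inter_right (isClosed_le continuous_const hd)
    obtain ⟨s, ⟨hs, hsδ⟩, hmin⟩ := hS.exists_isLeast ⟨t, ⟨ht, le_rfl⟩, hcon⟩
    have hlt : ∀ u ∈ Set.Ico 0 s, dist (y u) y₀ < δ := fun u hu => by
      by_contra! h
      exact absurd (hmin ⟨⟨hu.1, hu.2.le.trans hs.2⟩, h⟩) (not_le.2 hu.2)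
    have hs0 : 0 < s := hs.1.lt_of_ne fun h => by
      rw [← h] at hsδ
      exact absurd h0 (not_lt.2 hsδ)
    have hle : dist (y s) y₀ ≤ δ := by
      have hcl : s ∈ closure (Set.Ico 0 s) := by
        rw [closure_Ico hs0.ne]
        exact ⟨hs0.le, le_rfl⟩
      exact closure_minimal (t := {u | dist (y u) y₀ ≤ δ}) (fun u hu => (hlt u hu).le)
        (isClosed_le hd continuous_const) hcl
    have hle' : ∀ u ∈ Set.Icc 0 s, dist (y u) y₀ ≤ δ := fun u hu =>
      (hu.2.lt_or_eq).elim (fun h => (hlt u ⟨hu.1, h⟩).le) fun h => h ▸ hle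
    have hconst := constant_of_has_deriv_right_zero (f := fun u => f (y u)) (a := 0) (b := s)
      (fun u hu => (hf u (hle' u hu)).continuousAt.continuousWithinAt)
      (fun u hu => (hf u (hle' u ⟨hu.1, hu.2.le⟩)).hasDerivWithinAt) s ⟨hs0.le, le_rfl⟩
    exact absurd (hδ (y s) (le_antisymm hle hsδ)) (by simp [hconst])
  rcases le_total 0 t with ht | ht
  · exact key hy hf hδ h0 ht
  · have := key (y := fun s => y (-s)) (hy.comp continuous_neg)
      (fun s hs => ((hf (-s) hs).scomp s (hasDerivAt_neg s)).congr_deriv (smul_zero _))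
      (by simpa using hδ) (by simpa using h0) (neg_nonneg.2 ht)
    simpa using this

instance : CompactSpace SO3 := by
  refine isCompact_iff_compactSpace.1 ?_
  have hc : IsCompact (Set.univ.pi fun _ : Fin 3 => Set.univ.pi fun _ : Fin 3 =>
      Set.Icc (-1 : ℝ) 1) := isCompact_univ_pi fun _ => isCompact_univ_pi fun _ => isCompact_Icc
  refine IsCompact.of_isClosed_subset (X := Matrix (Fin 3) (Fin 3) ℝ) hc ?_ fun M hM => ?_
  · have : ((Matrix.specialOrthogonalGroup (Fin 3) ℝ : Submonoid _) :
        Set (Matrix (Fin 3) (Fin 3) ℝ)) = {M | M * Mᵀ = 1} ∩ {M | M.det = 1} :=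
      Set.ext fun M => SO3.mem_iff
    rw [this]
    exact (isClosed_eq (by fun_prop) continuous_const).inter (isClosed_eq (by fun_prop)
      continuous_const)
  · exact fun i _ j _ => abs_le.1 (SO3.abs_apply_le M (SO3.mem_iff.1 hM).1 i j)

theorem continuous_momentum : Continuous momentum := by
  unfold momentum
  exact Continuous.matrix_mulVec (continuous_subtype_val.comp continuous_fst) (by fun_prop)

theorem isClosedMap_body_momentum : IsClosedMap fun z : Phase => (z.2, momentum z) := by
  let j : Phase → SO3 × (BodyState × Vec3) := fun z => (z.1, (z.2, momentum z))
  have hj : Topology.IsClosedEmbedding j :=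
    Function.LeftInverse.isClosedEmbedding (f := fun p => (p.1, p.2.1)) (fun _ => rfl)
      (by fun_prop) (by have := continuous_momentum; fun_prop)
  exact isClosedMap_snd_of_compactSpace.comp hj.isClosedMap

/-- A neighbourhood of the orbit of `z` under the stabilizer of its momentum contains every point
whose body state and momentum are close to those of `z`. -/
theorem mem_of_body_momentum_near {z : Phase} {U : Set Phase}
    (hU : U ∈ 𝓝ˢ ((fun g => act g z) '' stabilizer (momentum z))) :
    ∀ᶠ p in 𝓝 (z.2, momentum z), ∀ x : Phase, (x.2, momentum x) = p → x ∈ U := by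
  refine isClosedMap_body_momentum.eventually_nhds_fiber (p := (· ∈ U)) _ fun x hx => ?_
  refine mem_nhdsSet_iff_forall.1 hU x ⟨(x.1 * z.1⁻¹, 1), ?_, ?_⟩
  · obtain ⟨h1, h2⟩ := Prod.mk.inj hx
    have : (x.1 * z.1⁻¹).1 *ᵥ (z.1.1 *ᵥ z.2.2.1) = x.1.1 *ᵥ x.2.2.1 := by
      rw [Matrix.mulVec_mulVec, h1]
      exact congrArg (fun B : SO3 => B.1 *ᵥ z.2.2.1) (inv_mul_cancel_right x.1 z.1)
    exact this.trans h2
  · obtain ⟨h1, h2⟩ := Prod.mk.inj hx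
    have h3 : signRot 1 = 1 := by
      apply Subtype.ext
      simp [signRot]
    refine Prod.ext ?_ ?_
    · simp [act, h3]
    · have h4 (v : Vec3) : signAct 1 v = v := by
        funext i
        simp [signAct]
      simp [act, h1, h4]

/-- An energy method: the body state stays near a strict nondegenerate minimum of a conserved
quantity, and the attitude is controlled by the conservation of momentum. -/
theorem isStable_of_conserved {I : Fin 3 → ℝ} {z : Phase} (hR : z.2.1 ≠ 0) {E : BodyState → ℝ}
    {c : ℝ} (hc : 0 < c) (hE : ∀ᶠ y in 𝓝 z.2, E z.2 + c * ‖y - z.2‖ ^ 2 ≤ E y)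
    (hE' : ∀ᶠ y in 𝓝 z.2, DifferentiableAt ℝ E y ∧ fderiv ℝ E y (bodyField I y) = 0) :
    IsStable I z := by
  intro U hU _
  have hnear := mem_of_body_momentum_near hU
  rw [nhds_prod_eq] at hnear
  obtain ⟨W, hW, V, hV, hWV⟩ := Filter.mem_prod_iff.1 hnear
  have hR' : ∀ᶠ y : BodyState in 𝓝 z.2, y.1 ≠ 0 := isOpen_fst_ne_zero.eventually_mem hR
  obtain ⟨ε, hε, hεall⟩ := Metric.nhds_basis_closedBall.mem_iff.1
    (Filter.inter_mem (Filter.inter_mem hE hE') (Filter.inter_mem hR' hW))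
  set δ := ε / 2 with hδ
  have hδ0 : 0 < δ := by positivity
  have hin {y : BodyState} (h : dist y z.2 ≤ δ) : y ∈ Metric.closedBall z.2 ε :=
    Metric.mem_closedBall.2 (by linarith)
  have hEc : ContinuousAt E z.2 := hE'.self_of_nhds.1.continuousAt
  have h1 : ∀ᶠ y in 𝓝 z.2, E y < E z.2 + c * δ ^ 2 :=
    hEc.eventually (gt_mem_nhds (by nlinarith [mul_pos hc (pow_pos hδ0 2)]))
  have hsnd : Filter.Tendsto (fun x : Phase => x.2) (𝓝 z) (𝓝 z.2) := continuous_snd.continuousAt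
  refine ⟨_, Filter.inter_mem (hsnd (Filter.inter_mem h1 (Metric.ball_mem_nhds z.2 hδ0)))
    (continuous_momentum.continuousAt hV), fun x ⟨⟨hx1, hx2⟩, hx3⟩ => ?_⟩
  obtain ⟨γ, hγ0, hγ⟩ := exists_cutoff_flow I z.2 hε (fun y hy => (hεall hy).2.1) x
  have hcont : Continuous fun t => (γ t).2 := continuous_iff_continuousAt.2 fun t => by
    obtain ⟨_, _, h, _⟩ := hγ t
    exact h.continuousAt
  have hstay : ∀ t, dist (γ t).2 z.2 < δ := by
    refine dist_lt_of_conserved (f := E) hcont (fun t ht => ?_) (fun y hy => ?_) ?_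
    · obtain ⟨a, -, h, -⟩ := hγ t
      obtain ⟨hd, h0⟩ := (hεall (hin ht)).1.2
      refine (hd.hasFDerivAt.comp_hasDerivAt t h).congr_deriv ?_
      rw [map_smul, h0, smul_zero]
    · have := (hεall (hin hy.le)).1.1
      rw [Set.mem_ofPred_eq, ← dist_eq_norm, hy] at this
      rw [hγ0]
      exact lt_of_lt_of_le hx1 this
    · rw [hγ0]
      exact hx2
  have hmom : ∀ t, momentum (γ t) = momentum x := by
    intro t
    funext i
    have hd (t : ℝ) : HasDerivAt (fun s => momentum (γ s) i) 0 t := by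
      obtain ⟨a, ha, hy, hB⟩ := hγ t
      have hne : (γ t).2.1 ≠ 0 := (hεall (hin (hstay t).le)).2.1
      have hp (j : Fin 3) : HasDerivAt (fun s => (γ s).2.2.1 j)
          (a * ((γ t).2.2.1 ⨯₃ omega I (γ t).2) j) t := by
        rw [← gradPi_eq I hne]
        exact hasDerivAt_pi.1 hy.snd.fst j
      have := (((hB i 0).mul (hp 0)).add ((hB i 1).mul (hp 1))).add ((hB i 2).mul (hp 2))
      refine (this.congr_deriv ?_).congr_of_eventuallyEq (.of_forall fun s => ?_)
      · simp [Matrix.mul_apply, Fin.sum_univ_three, hat, cross_apply]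
        ring
      · simp [momentum, Matrix.mulVec, dotProduct, Fin.sum_univ_three]
    rw [is_const_of_deriv_eq_zero (fun t => (hd t).differentiableAt) (fun t => (hd t).deriv) t 0,
      hγ0]
  refine ⟨γ, fun t => ?_, hγ0, fun t => ?_⟩
  · obtain ⟨a, ha, hy, hB⟩ := hγ t
    have hne : (γ t).2.1 ≠ 0 := (hεall (hin (hstay t).le)).2.1
    obtain rfl : a = 1 := ha (Metric.mem_closedBall.2 (hstay t).le)
    refine ⟨hne, by simpa using hy, fun i j => ?_⟩
    rw [gradPi_eq I hne]
    simpa using hB i j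
  · have hx3' : momentum x ∈ V := hx3
    exact hWV (Set.mk_mem_prod (hεall (hin (hstay t).le)).2.2 hx3') (γ t) (by rw [hmom t])

/-! ### Second order expansions and quadratic forms -/

/-- A twice differentiable function agrees with its second order Taylor polynomial up to
`o(‖y - x‖ ^ 2)`. -/
theorem isLittleO_taylor_two {E : Type*} [NormedAddCommGroup E] [NormedSpace ℝ E] {f : E → ℝ}
    {x : E} (hf : ContDiffAt ℝ 2 f x) :
    (fun y => f y - f x - fderiv ℝ f x (y - x) - fderiv ℝ (fderiv ℝ f) x (y - x) (y - x) / 2)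
      =o[𝓝 x] fun y => ‖y - x‖ ^ 2 := by
  set A := fderiv ℝ (fderiv ℝ f) x with hA
  have h1 : ∀ᶠ y in 𝓝 x, HasFDerivAt f (fderiv ℝ f y) y :=
    (hf.eventually (by norm_num)).mono fun y hy => (hy.differentiableAt (by norm_num)).hasFDerivAt
  have h2 : HasFDerivAt (fderiv ℝ f) A x :=
    ((hf.fderiv_right (m := 1) (by norm_num)).differentiableAt (by norm_num)).hasFDerivAt
  have hsymm (v w : E) : A v w = A w v := second_derivative_symmetric_of_eventually h1 h2 v w
  have hg : ∀ᶠ y in 𝓝 x, HasFDerivAt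
      (fun y => f y - f x - fderiv ℝ f x (y - x) - A (y - x) (y - x) / 2)
      (fderiv ℝ f y - fderiv ℝ f x - A (y - x)) y := by
    filter_upwards [h1] with y hy
    have hid : HasFDerivAt (fun y => y - x) (ContinuousLinearMap.id ℝ E) y :=
      (hasFDerivAt_id y).sub_const x
    have h3 := (A.hasFDerivAt.comp y hid).clm_apply hid
    have h4 := (fderiv ℝ f x).hasFDerivAt.comp y hid
    refine (((hy.sub_const (f x)).sub h4).sub (h3.mul_const (1 / 2))).congr_fderiv
      ?_ |>.congr_of_eventuallyEq (.of_forall fun z => ?_)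
    · ext v
      have hs := hsymm v (y - x)
      simp at hs ⊢
      linarith
    · simp
      ring
  refine Asymptotics.isLittleO_iff.2 fun ε hε => ?_
  have h5 := h2.isLittleO.def hε
  obtain ⟨δ, hδ, hball⟩ := Metric.eventually_nhds_iff_ball.1 (hg.and h5)
  filter_upwards [Metric.ball_mem_nhds x hδ] with y hy
  have hsub : Metric.closedBall x ‖y - x‖ ⊆ Metric.ball x δ := by
    rw [← dist_eq_norm]
    exact Metric.closedBall_subset_ball hy
  have := (convex_closedBall x ‖y - x‖).norm_image_sub_le_of_norm_hasFDerivWithin_le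
    (C := ε * ‖y - x‖) (fun z hz => (hball z (hsub hz)).1.hasFDerivWithinAt)
    (fun z hz => ((hball z (hsub hz)).2).trans ?_) (Metric.mem_closedBall_self (norm_nonneg _))
    (y := y) (by simp [dist_eq_norm])
  · simp only [sub_self, map_zero, zero_div, sub_zero] at this
    refine this.trans_eq ?_
    rw [norm_pow, norm_norm]
    ring
  · have : ‖z - x‖ ≤ ‖y - x‖ := by simpa [dist_eq_norm] using hz
    gcongr

/-- Finsler's lemma: a form that is positive on the zeros of a nonnegative form becomes positive
definite after adding a large multiple of the latter. -/
theorem exists_add_mul_ge_norm_sq {E : Type*} [NormedAddCommGroup E] [NormedSpace ℝ E]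
    [ProperSpace E] {q g : E → ℝ} (hq : Continuous q) (hg : Continuous g)
    (hq2 : ∀ (t : ℝ) v, q (t • v) = t ^ 2 * q v) (hg2 : ∀ (t : ℝ) v, g (t • v) = t ^ 2 * g v)
    (hg0 : ∀ v, 0 ≤ g v) (hpos : ∀ v, v ≠ 0 → g v = 0 → 0 < q v) :
    ∃ N > 0, ∃ c > 0, ∀ v, c * ‖v‖ ^ 2 ≤ q v + N * g v := by
  have hS : IsCompact (Metric.sphere (0 : E) 1) := isCompact_sphere 0 1
  have hne {v : E} (hv : v ∈ Metric.sphere (0 : E) 1) : v ≠ 0 := by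
    rintro rfl
    simp at hv
  obtain ⟨m, hm, hmg⟩ := (hS.inter_right (isClosed_le hq continuous_const)).exists_forall_le'
    (f := g) (a := 0) hg.continuousOn fun v hv => (hg0 v).lt_of_ne fun h =>
      absurd (hpos v (hne hv.1) h.symm) (not_lt.2 hv.2)
  obtain ⟨C, hC⟩ := hS.exists_bound_of_continuousOn hq.continuousOn
  set N := (|C| + 1) / m with hN
  have hN0 : 0 < N := by positivity
  obtain ⟨c, hc, hcq⟩ := hS.exists_forall_le' (f := fun v => q v + N * g v) (a := 0)
    (by fun_prop) fun v hv => by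
      by_cases h : q v ≤ 0
      · have h1 := hmg v ⟨hv, h⟩
        have h2 := (abs_le.1 (hC v hv)).1
        have h3 : N * m = |C| + 1 := by rw [hN]; field_simp
        have h4 : N * m ≤ N * g v := by gcongr
        linarith [le_abs_self C]
      · have := mul_nonneg hN0.le (hg0 v)
        linarith
  refine ⟨N, hN0, c, hc, fun v => ?_⟩
  by_cases hv : v = 0
  · have hq0 : q 0 = 0 := by simpa using hq2 0 0
    have hg0 : g 0 = 0 := by simpa using hg2 0 0
    simp [hv, hq0, hg0]
  · have hv' : 0 < ‖v‖ := norm_pos_iff.2 hv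
    have h1 := hcq (‖v‖⁻¹ • v) (by simp [norm_smul, hv'.ne'])
    rw [hq2, hg2] at h1
    have h2 : q v + N * g v = ‖v‖ ^ 2 * ((‖v‖⁻¹) ^ 2 * q v + N * ((‖v‖⁻¹) ^ 2 * g v)) := by
      field_simp
    rw [h2, mul_comm c]
    gcongr

theorem binary_form_pos {A B C x y : ℝ} (hA : 0 < A) (hdet : B ^ 2 < A * C) (h : x ≠ 0 ∨ y ≠ 0) :
    0 < A * x ^ 2 + 2 * B * x * y + C * y ^ 2 := by
  have key : A * (A * x ^ 2 + 2 * B * x * y + C * y ^ 2) =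
      (A * x + B * y) ^ 2 + (A * C - B ^ 2) * y ^ 2 := by ring
  refine pos_of_mul_pos_right (a := A) ?_ hA.le
  rw [key]
  by_cases hy : y = 0
  · have hx : x ≠ 0 := by simpa [hy] using h
    simp only [hy]
    have : 0 < (A * x) ^ 2 := by positivity
    simpa using this
  · have : 0 < (A * C - B ^ 2) * y ^ 2 := mul_pos (by linarith) (by positivity)
    positivity

theorem binary_form_nonneg {A B C : ℝ} (hA : 0 < A) (hdet : B ^ 2 < A * C) (x y : ℝ) :
    0 ≤ A * x ^ 2 + 2 * B * x * y + C * y ^ 2 := by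
  by_cases h : x ≠ 0 ∨ y ≠ 0
  · exact (binary_form_pos hA hdet h).le
  · simp only [not_or, not_not] at h
    simp [h]

/-! ### The second variation of the energy -/

/-- The energy-Casimir function: `H - |Π|² / (2 a) + N (|Π|² - m)²`. -/
def energy (I : Fin 3 → ℝ) (a m N : ℝ) (y : BodyState) : ℝ :=
  hamiltonian I y - (y.2.1 ⬝ᵥ y.2.1) / (2 * a) + N * (y.2.1 ⬝ᵥ y.2.1 - m) ^ 2

theorem contDiffAt_energy (I : Fin 3 → ℝ) (a m N : ℝ) {y : BodyState} (hR : y.1 ≠ 0) :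
    ContDiffAt ℝ 2 (energy I a m N) y := by
  have := contDiffAt_hamiltonian I hR
  unfold energy
  simp only [dotProduct, Fin.sum_univ_three]
  fun_prop

theorem fderiv_energy_apply (I : Fin 3 → ℝ) (a m N : ℝ) {y : BodyState} (hR : y.1 ≠ 0)
    (v : BodyState) : fderiv ℝ (energy I a m N) y v =
      (omega I y ⨯₃ y.2.2 + gradV I y.1) ⬝ᵥ v.1 + omega I y ⬝ᵥ v.2.1
        + (y.2.2 - omega I y ⨯₃ y.1) ⬝ᵥ v.2.2 - (y.2.1 ⬝ᵥ v.2.1) / a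
        + 4 * N * (y.2.1 ⬝ᵥ y.2.1 - m) * (y.2.1 ⬝ᵥ v.2.1) := by
  rw [← fderiv_hamiltonian_apply I hR,
    ← ((contDiffAt_energy I a m N hR).differentiableAt (by norm_num)).lineDeriv_eq_fderiv]
  refine HasDerivAt.deriv ?_
  have hH := ((contDiffAt_hamiltonian I hR).differentiableAt
    (by norm_num)).hasFDerivAt.hasLineDerivAt v
  have h0 : (fun t : ℝ => (y + t • v).2.1 ⬝ᵥ (y + t • v).2.1) =
      fun t => y.2.1 ⬝ᵥ y.2.1 + t * (2 * (y.2.1 ⬝ᵥ v.2.1)) + t ^ 2 * (v.2.1 ⬝ᵥ v.2.1) := by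
    funext t
    simp only [dotProduct, Fin.sum_univ_three, Prod.snd_add, Prod.fst_add, Prod.smul_snd,
      Prod.smul_fst, Pi.add_apply, Pi.smul_apply, smul_eq_mul]
    ring
  have h1 : HasDerivAt (fun t : ℝ => (y + t • v).2.1 ⬝ᵥ (y + t • v).2.1)
      (2 * (y.2.1 ⬝ᵥ v.2.1)) 0 := by
    rw [h0]
    have h1 := ((hasDerivAt_id (0 : ℝ)).mul_const (2 * (y.2.1 ⬝ᵥ v.2.1))).const_add (y.2.1 ⬝ᵥ y.2.1)
    have h2 := ((hasDerivAt_id (0 : ℝ)).pow 2).mul_const (v.2.1 ⬝ᵥ v.2.1)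
    exact (h1.add h2).congr_deriv (by simp)
  refine ((hH.sub (h1.div_const (2 * a))).add (((h1.sub_const m).pow 2).const_mul N)).congr_deriv ?_
  simp only [zero_smul, add_zero]
  rw [mul_div_mul_left _ _ two_ne_zero]
  norm_num
  ring

theorem fderiv_energy_bodyField (I : Fin 3 → ℝ) (a m N : ℝ) {y : BodyState} (hR : y.1 ≠ 0) :
    fderiv ℝ (energy I a m N) y (bodyField I y) = 0 := by
  rw [fderiv_energy_apply I a m N hR, bodyField_eq I hR]
  simp only [dotProduct, Fin.sum_univ_three, cross_apply, Matrix.cons_val, Pi.add_apply,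
    Pi.neg_apply, Pi.sub_apply]
  ring

/-- The second variation of `H - |Π|² / (2 a)` at `baseState I r w`, where `a = I 0 + r ^ 2`. -/
def secondVariation (I : Fin 3 → ℝ) (r w : ℝ) (v : BodyState) : ℝ :=
  (v.2.1 0 - r * v.2.2 2 - w * r * v.1 1) ^ 2 / I 0 + (v.2.1 1 + w * r * v.1 0) ^ 2 / I 1
    + (v.2.1 2 + r * v.2.2 0) ^ 2 / I 2 + (v.2.2 0 ^ 2 + v.2.2 1 ^ 2 + v.2.2 2 ^ 2)
    - 2 * w * v.1 1 * v.2.2 2 + 2 * w * v.1 2 * v.2.2 1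
    + (hessV I |r| 0 * v.1 0 ^ 2 + hessV I |r| 1 * v.1 1 ^ 2 + hessV I |r| 2 * v.1 2 ^ 2)
    - (v.2.1 0 ^ 2 + v.2.1 1 ^ 2 + v.2.1 2 ^ 2) / (I 0 + r ^ 2)

theorem fderiv_energy_baseState {I : Fin 3 → ℝ} (hI : ∀ i, 0 < I i) {r w : ℝ} (hr : r ≠ 0)
    (hw : w ^ 2 = freqSq I |r|) (N : ℝ) :
    fderiv ℝ (energy I (I 0 + r ^ 2) (((I 0 + r ^ 2) * w) ^ 2) N) (baseState I r w) = 0 := by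
  refine ContinuousLinearMap.ext fun v => ?_
  have ha : I 0 + r ^ 2 ≠ 0 := by have := hI 0; positivity
  rw [fderiv_energy_apply _ _ _ _ (axis_ne_zero hr), omega_baseState (fun i => (hI i).ne')]
  simp only [baseState]
  rw [gradV_axis I hr, ← hw]
  simp [dotProduct, Fin.sum_univ_three, cross_apply]
  field_simp
  ring

theorem fderiv_fderiv_energy_baseState {I : Fin 3 → ℝ} (hI : ∀ i, 0 < I i) {r w : ℝ} (hr : r ≠ 0)
    (N : ℝ) (v : BodyState) :
    fderiv ℝ (fderiv ℝ (energy I (I 0 + r ^ 2) (((I 0 + r ^ 2) * w) ^ 2) N)) (baseState I r w) v v =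
      secondVariation I r w v + N * (8 * ((I 0 + r ^ 2) * w) ^ 2 * v.2.1 0 ^ 2) := by
  have ha : 0 < I 0 + r ^ 2 := by have := hI 0; positivity
  set y := baseState I r w with hy
  set a := I 0 + r ^ 2 with ha'
  have hR : y.1 ≠ 0 := axis_ne_zero hr
  have hd := (((contDiffAt_energy I a ((a * w) ^ 2) N hR).fderiv_right (m := 1)
    (by norm_num)).differentiableAt (by norm_num)).hasFDerivAt
  have hd' : HasDerivAt (fun t : ℝ => fderiv ℝ (energy I a ((a * w) ^ 2) N) (y + t • v) v)
      (fderiv ℝ (fderiv ℝ (energy I a ((a * w) ^ 2) N)) y v v) 0 := by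
    have := (hd.hasLineDerivAt v).clm_apply (hasDerivAt_const (0 : ℝ) v)
    simpa using this
  have hc : HasDerivAt (fun t : ℝ => y + t • v) v 0 := by
    simpa using ((hasDerivAt_id (0 : ℝ)).smul_const v).const_add y
  have h1 : HasDerivAt (fun t : ℝ => (y + t • v).1) v.1 0 := hc.fst
  have h2 : HasDerivAt (fun t : ℝ => (y + t • v).2.1) v.2.1 0 := hc.snd.fst
  have h3 : HasDerivAt (fun t : ℝ => (y + t • v).2.2) v.2.2 0 := hc.snd.snd
  have ho := hasDerivAt_omega I hc
  have hg : HasDerivAt (fun t : ℝ => gradV I (y + t • v).1) (fderiv ℝ (gradV I) y.1 v.1) 0 :=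
    ((contDiffAt_gradV I hR).differentiableAt (by norm_num)).hasFDerivAt.hasLineDerivAt v.1
  have hcst (u : Vec3) := hasDerivAt_const (0 : ℝ) u
  have key := (((((ho.crossProduct h3).add hg).dotProduct (hcst v.1)).add
    (ho.dotProduct (hcst v.2.1))).add ((h3.sub (ho.crossProduct h1)).dotProduct (hcst v.2.2))).sub
    ((h2.dotProduct (hcst v.2.1)).div_const a) |>.add
    ((((h2.dotProduct h2).sub_const ((a * w) ^ 2)).const_mul (4 * N)).mul
      (h2.dotProduct (hcst v.2.1)))
  have hnear := hc.continuousAt.eventually_mem (isOpen_fst_ne_zero.mem_nhds (by simpa using hR))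
  rw [hd'.unique (key.congr_of_eventuallyEq (hnear.mono fun t ht =>
    fderiv_energy_apply I a ((a * w) ^ 2) N ht v))]
  simp only [zero_smul, add_zero, dotProduct_zero]
  rw [hy, omega_baseState (fun i => (hI i).ne')]
  simp only [baseState, ← ha']
  rw [fderiv_gradV_axis I hr]
  have := hI 0; have := hI 1; have := hI 2
  simp [dotProduct, Fin.sum_univ_three, cross_apply, linOmega, secondVariation, ← ha']
  field_simp
  ring

/-! ### Positivity of the second variation -/

/-- The polynomial whose positive root is the critical radius. -/
def critPoly (I : Fin 3 → ℝ) (l : ℝ) : ℝ :=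
  2 * l ^ 4 + (9 * I 1 - 6 * I 0 - 3) * l ^ 2 - 15 * I 0 + 45 * I 0 * I 1

/-- The second derivative of the amended potential in the radial direction has the sign of
`critPoly`. -/
theorem radial_curvature_eq (I : Fin 3 → ℝ) {l : ℝ} (hl : 0 < l) :
    (I 0 + l ^ 2) * hessV I l 1 + freqSq I l * (3 * l ^ 2 - I 0) = critPoly I l / (2 * l ^ 5) := by
  simp only [hessV, freqSq, critPoly, Matrix.cons_val]
  field_simp
  ring

/-- The part of the second variation that involves the radial displacement `x` and the tangential
linear momentum `p`, on the level set of the momentum. -/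
def radialForm (I : Fin 3 → ℝ) (r w p x : ℝ) : ℝ :=
  (1 + r ^ 2 / I 0) * p ^ 2 + 2 * (w * (r ^ 2 / I 0 - 1)) * p * x
    + (hessV I |r| 1 + w ^ 2 * r ^ 2 / I 0) * x ^ 2

/-- The discriminant of the radial form is, up to a positive factor, the critical polynomial. -/
theorem radialForm_det {I : Fin 3 → ℝ} (hI0 : 0 < I 0) {r w : ℝ} (hr : r ≠ 0)
    (hw : w ^ 2 = freqSq I |r|) :
    (1 + r ^ 2 / I 0) * (hessV I |r| 1 + w ^ 2 * r ^ 2 / I 0) - (w * (r ^ 2 / I 0 - 1)) ^ 2 =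
      critPoly I |r| / (2 * |r| ^ 5 * I 0) := by
  have h := radial_curvature_eq I (abs_pos.2 hr)
  rw [← hw, sq_abs] at h
  rw [← div_div, ← h]
  field_simp
  ring

/-- On the kernel of the differential of `|Π|²` the second variation splits into the radial form and
three binary forms, which are positive definite by the Lagrange conditions. -/
theorem secondVariation_pos {I : Fin 3 → ℝ} (hI : ∀ i, 0 < I i) (h02 : I 2 < I 0) (h21 : I 1 < I 2)
    {r w : ℝ} (hr : r ≠ 0) (hw0 : w ≠ 0) (hw : w ^ 2 = freqSq I |r|) {v : BodyState} (hv : v ≠ 0)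
    (hv0 : v.2.1 0 = 0)
    (hrad : v.1 1 ≠ 0 ∨ v.2.2 2 ≠ 0 → 0 < radialForm I r w (v.2.2 2) (v.1 1)) :
    0 < secondVariation I r w v := by
  have h0 := hI 0
  have h1 := hI 1
  have h2 := hI 2
  have hl : 0 < |r| := abs_pos.2 hr
  have hr2 : 0 < r ^ 2 := by positivity
  have hw2 : 0 < w ^ 2 := by positivity
  have hα : w ^ 2 < hessV I |r| 0 := by
    have : 0 < 3 * (I 0 - I 1) / |r| ^ 5 := div_pos (by linarith) (by positivity)
    simp only [hessV, Matrix.cons_val, ← hw]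
    linarith
  have hγ : w ^ 2 < hessV I |r| 2 := by
    have : 0 < 3 * (I 2 - I 1) / |r| ^ 5 := div_pos (by linarith) (by positivity)
    simp only [hessV, Matrix.cons_val, ← hw]
    linarith
  obtain ⟨ρ, q, p⟩ := v
  simp only at hv0 hrad
  set a := I 0 + r ^ 2 with ha
  have ha0 : 0 < a := by positivity
  have hdec : secondVariation I r w (ρ, q, p) = radialForm I r w (p 2) (ρ 1)
      + (1 * p 1 ^ 2 + 2 * w * p 1 * ρ 2 + hessV I |r| 2 * ρ 2 ^ 2)
      + ((1 / I 1 - 1 / a) * q 1 ^ 2 + 2 * (w * r / I 1) * q 1 * ρ 0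
        + ((w * r) ^ 2 / I 1 + hessV I |r| 0) * ρ 0 ^ 2)
      + ((1 / I 2 - 1 / a) * q 2 ^ 2 + 2 * (r / I 2) * q 2 * p 0 + (r ^ 2 / I 2 + 1) * p 0 ^ 2) := by
    simp only [secondVariation, radialForm, hv0]
    field_simp
    ring
  rw [hdec]
  have hA1 : 0 < 1 / I 1 - 1 / a := sub_pos.2 (one_div_lt_one_div_of_lt h1 (by linarith))
  have hA2 : 0 < 1 / I 2 - 1 / a := sub_pos.2 (one_div_lt_one_div_of_lt h2 (by linarith))
  have hd0 : w ^ 2 < 1 * hessV I |r| 2 := by linarith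
  have hd1 : (w * r / I 1) ^ 2 < (1 / I 1 - 1 / a) * ((w * r) ^ 2 / I 1 + hessV I |r| 0) := by
    have h : (1 / I 1 - 1 / a) * ((w * r) ^ 2 / I 1 + hessV I |r| 0) - (w * r / I 1) ^ 2 =
        ((a - I 1) * hessV I |r| 0 - w ^ 2 * r ^ 2) / (I 1 * a) := by
      field_simp
      ring
    have h' : 0 < (a - I 1) * hessV I |r| 0 - w ^ 2 * r ^ 2 := by
      have : w ^ 2 * r ^ 2 < (a - I 1) * hessV I |r| 0 := by
        rw [mul_comm]
        exact mul_lt_mul'' (by linarith) hα hr2.le hw2.le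
      linarith
    have := div_pos h' (mul_pos h1 ha0)
    linarith
  have hd2 : (r / I 2) ^ 2 < (1 / I 2 - 1 / a) * (r ^ 2 / I 2 + 1) := by
    have h : (1 / I 2 - 1 / a) * (r ^ 2 / I 2 + 1) - (r / I 2) ^ 2 = (I 0 - I 2) / (I 2 * a) := by
      field_simp
      rw [ha]
      ring
    have := div_pos (sub_pos.2 h02) (mul_pos h2 ha0)
    linarith
  have n0 := binary_form_nonneg one_pos hd0 (p 1) (ρ 2)
  have n1 := binary_form_nonneg hA1 hd1 (q 1) (ρ 0)
  have n2 := binary_form_nonneg hA2 hd2 (q 2) (p 0)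
  by_cases c : ρ 1 ≠ 0 ∨ p 2 ≠ 0
  · linarith [hrad c]
  simp only [not_or, not_not] at c
  have hrad0 : radialForm I r w (p 2) (ρ 1) = 0 := by simp [radialForm, c]
  by_cases c0 : p 1 ≠ 0 ∨ ρ 2 ≠ 0
  · linarith [binary_form_pos one_pos hd0 c0]
  by_cases c1 : q 1 ≠ 0 ∨ ρ 0 ≠ 0
  · linarith [binary_form_pos hA1 hd1 c1]
  by_cases c2 : q 2 ≠ 0 ∨ p 0 ≠ 0
  · linarith [binary_form_pos hA2 hd2 c2]
  simp only [not_or, not_not] at c0 c1 c2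
  refine absurd (Prod.ext (funext fun i => ?_) (Prod.ext (funext fun i => ?_)
    (funext fun i => ?_))) hv <;> fin_cases i <;> simp [c, c0, c1, c2, hv0]

theorem continuous_secondVariation (I : Fin 3 → ℝ) (r w : ℝ) :
    Continuous (secondVariation I r w) := by
  unfold secondVariation
  fun_prop

theorem secondVariation_smul (I : Fin 3 → ℝ) (r w t : ℝ) (v : BodyState) :
    secondVariation I r w (t • v) = t ^ 2 * secondVariation I r w v := by
  simp only [secondVariation, Prod.smul_fst, Prod.smul_snd, Pi.smul_apply, smul_eq_mul]
  ring

/-- If the critical polynomial is positive, the energy-Casimir function has a nondegenerate minimum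
at the relative equilibrium. -/
theorem isStable_of_critPoly_pos {I : Fin 3 → ℝ} (hI : ∀ i, 0 < I i) (h02 : I 2 < I 0)
    (h21 : I 1 < I 2) {r w : ℝ} (hr : r ≠ 0) (hw0 : w ≠ 0) (hw : w ^ 2 = freqSq I |r|)
    (hcrit : 0 < critPoly I |r|) {z : Phase} (hz : z.2 = baseState I r w) : IsStable I z := by
  have h0 := hI 0
  have hl : 0 < |r| := abs_pos.2 hr
  have hrad {p x : ℝ} (h : x ≠ 0 ∨ p ≠ 0) : 0 < radialForm I r w p x := by
    refine binary_form_pos (by positivity) ?_ h.symm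
    have := radialForm_det h0 hr hw
    have : 0 < critPoly I |r| / (2 * |r| ^ 5 * I 0) := by positivity
    linarith
  set a := I 0 + r ^ 2 with ha
  have haw : a * w ≠ 0 := mul_ne_zero (by positivity) hw0
  obtain ⟨N, hN, c, hc, hq⟩ := exists_add_mul_ge_norm_sq (continuous_secondVariation I r w)
    (g := fun v : BodyState => 8 * (a * w) ^ 2 * v.2.1 0 ^ 2) (by fun_prop)
    (secondVariation_smul I r w) (fun t v => by simp; ring) (fun v => by positivity)
    (fun v hv hv0 => secondVariation_pos hI h02 h21 hr hw0 hw hv (by simpa [haw] using hv0) hrad)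
  have hR : z.2.1 ≠ 0 := by rw [hz]; exact axis_ne_zero hr
  refine isStable_of_conserved (E := energy I a ((a * w) ^ 2) N) hR (c := c / 4) (by positivity) ?_ ?_
  · have ht := (isLittleO_taylor_two (contDiffAt_energy I a ((a * w) ^ 2) N hR)).def
      (show 0 < c / 4 by positivity)
    filter_upwards [ht] with y hy
    rw [hz, fderiv_energy_baseState hI hr hw, fderiv_fderiv_energy_baseState hI hr] at hy
    rw [hz]
    have h1 := hq (y - baseState I r w)
    have h2 := (abs_le.1 hy).1
    simp only [norm_pow, norm_norm, zero_apply] at h2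
    linarith
  · filter_upwards [isOpen_fst_ne_zero.eventually_mem hR] with y hy
    exact ⟨(contDiffAt_energy I a _ N hy).differentiableAt (by norm_num),
      fderiv_energy_bodyField I a _ N hy⟩

/-! ### An instability criterion -/

/-- Prescribing the absolute values of a continuous function up to `δ` prevents sign changes. -/
theorem abs_sub_lt_of_abs_abs_sub_lt {f : ℝ → ℝ} (hf : Continuous f) {c δ : ℝ}
    (hδ : c = 0 ∨ δ ≤ |c|) (h : ∀ t, |(|f t| - |c|)| < δ) (h0 : |f 0 - c| < δ) (t : ℝ) :
    |f t - c| < δ := by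
  have key {f : ℝ → ℝ} (hf : Continuous f) {c : ℝ} (hc : 0 < c) (hδ : δ ≤ c)
      (h : ∀ t, |(|f t| - c)| < δ) (h0 : |f 0 - c| < δ) : |f t - c| < δ := by
    have hne (s : ℝ) : f s ≠ 0 := fun hs => by
      have := h s
      rw [hs, abs_zero, zero_sub, abs_neg, abs_of_pos hc] at this
      linarith
    have h0' : 0 < f 0 := by linarith [(abs_lt.1 h0).1]
    have ht : 0 < f t := by
      by_contra! hcon
      obtain ⟨s, hs⟩ := mem_range_of_exists_le_of_exists_ge hf ⟨t, hcon⟩ ⟨0, h0'.le⟩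
      exact hne s hs
    simpa [abs_of_pos ht] using h t
  rcases lt_trichotomy c 0 with hc | rfl | hc
  · have := key (f := fun s => -f s) hf.neg (c := -c) (by linarith)
      (by simpa [hc.ne, abs_of_neg hc] using hδ) (by simpa [abs_of_neg hc] using h)
      (by rwa [← neg_add', abs_neg, ← sub_eq_add_neg])
    rwa [← neg_add', abs_neg, ← sub_eq_add_neg] at this
  · simpa using h t
  · exact key hf hc (by simpa [hc.ne', abs_of_pos hc] using hδ)
      (by simpa [abs_of_pos hc] using h) h0

theorem dist_bodyState_lt_iff {x y : BodyState} {δ : ℝ} (hδ : 0 < δ) :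
    dist x y < δ ↔ (∀ i, |x.1 i - y.1 i| < δ) ∧ (∀ i, |x.2.1 i - y.2.1 i| < δ) ∧
      ∀ i, |x.2.2 i - y.2.2 i| < δ := by
  simp only [Prod.dist_eq, max_lt_iff, dist_pi_lt_iff hδ, Real.dist_eq]

/-- The points whose body coordinates agree with those of `y₀` up to signs and an error `δ`: a
neighbourhood that is invariant under the whole symmetry group. -/
def signNhd (y₀ : BodyState) (δ : ℝ) : Set Phase :=
  {x | (∀ i, |(|x.2.1 i| - |y₀.1 i|)| < δ) ∧ (∀ i, |(|x.2.2.1 i| - |y₀.2.1 i|)| < δ) ∧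
    ∀ i, |(|x.2.2.2 i| - |y₀.2.2 i|)| < δ}

theorem isOpen_signNhd (y₀ : BodyState) (δ : ℝ) : IsOpen (signNhd y₀ δ) := by
  simp only [signNhd, Set.ofPred_and, Set.ofPred_forall]
  refine IsOpen.inter ?_ (IsOpen.inter ?_ ?_) <;>
    exact isOpen_iInter_of_finite fun i => isOpen_lt (by fun_prop) continuous_const

theorem abs_intUnits_mul (e : ℤˣ) (a : ℝ) : |((e : ℤ) : ℝ) * a| = |a| := by
  rcases Int.units_eq_one_or e with rfl | rfl <;> simp

theorem act_mem_signNhd_iff {y₀ : BodyState} {δ : ℝ} (g : Sym) {x : Phase} :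
    act g x ∈ signNhd y₀ δ ↔ x ∈ signNhd y₀ δ := by
  have h (i : Fin 3) : |(act g x).2.2.1 i| = |x.2.2.1 i| := by
    change |((∏ j, g.2 j : ℤˣ) : ℤ) • (((g.2 i : ℤ) : ℝ) * x.2.2.1 i)| = _
    rw [zsmul_eq_mul, abs_intUnits_mul, abs_intUnits_mul]
  simp only [signNhd, Set.mem_ofPred_eq, h]
  simp only [act, signAct, abs_intUnits_mul]

/-- Chetaev's criterion: the relative equilibrium is unstable if some function increases along
solutions at a rate bounded below by the energy deficit, and the energy has no minimum. -/
theorem not_isStable_of_deficit {I : Fin 3 → ℝ} {z : Phase}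
    {E F : BodyState → ℝ} {κ : ℝ} (hκ : 0 < κ)
    (hE : ∀ᶠ y in 𝓝 z.2, DifferentiableAt ℝ E y ∧ fderiv ℝ E y (bodyField I y) = 0)
    (hF : ∀ᶠ y in 𝓝 z.2, DifferentiableAt ℝ F y ∧
      κ * (E z.2 - E y) ≤ fderiv ℝ F y (bodyField I y))
    (hneg : ∃ᶠ y in 𝓝 z.2, E y < E z.2) : ¬ IsStable I z := by
  intro hst
  obtain ⟨ε, hε, hεall⟩ := Metric.nhds_basis_closedBall.mem_iff.1 (Filter.inter_mem hE hF)
  have hcoord (c : ℝ) : ∀ᶠ δ in 𝓝[>] (0 : ℝ), c = 0 ∨ δ ≤ |c| := by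
    by_cases hc : c = 0
    · simp [hc]
    · exact ((eventually_le_nhds (abs_pos.2 hc)).filter_mono nhdsWithin_le_nhds).mono
        fun δ h => Or.inr h
  -- a radius for which the absolute values of the nonzero coordinates determine their signs
  obtain ⟨δ, ⟨⟨⟨hδ1, hδ2⟩, hδ3⟩, hδε⟩, hδ0⟩ := ((((Filter.eventually_all.2 fun i =>
    hcoord (z.2.1 i)).and (Filter.eventually_all.2 fun i => hcoord (z.2.2.1 i))).and
    (Filter.eventually_all.2 fun i => hcoord (z.2.2.2 i))).and
    ((eventually_le_nhds hε).filter_mono nhdsWithin_le_nhds)).and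
    (self_mem_nhdsWithin (s := Set.Ioi (0 : ℝ))) |>.exists
  replace hδ0 : 0 < δ := hδ0
  have hzU : z ∈ signNhd z.2 δ := by simp [signNhd, hδ0]
  obtain ⟨O, hO, hOγ⟩ := hst (signNhd z.2 δ)
    ((isOpen_signNhd _ _).mem_nhdsSet.2 (Set.image_subset_iff.2 fun g _ =>
      (act_mem_signNhd_iff g).2 hzU)) (fun g _ x hx => (act_mem_signNhd_iff g).2 hx)
  have hcont : Filter.Tendsto (fun y : BodyState => ((z.1, y) : Phase)) (𝓝 z.2) (𝓝 z) :=
    (Continuous.prodMk_right z.1).continuousAt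
  obtain ⟨y, hyE, hyO, hyδ⟩ := (hneg.and_eventually
    ((hcont.eventually hO).and (Metric.ball_mem_nhds z.2 hδ0))).exists
  obtain ⟨γ, hγ, hγ0, hγU⟩ := hOγ _ hyO
  have hγ0' : (γ 0).2 = y := by rw [hγ0]
  have hγc : Continuous fun t => (γ t).2 :=
    continuous_iff_continuousAt.2 fun t => (hγ t).2.1.continuousAt
  have hstay (t : ℝ) : (γ t).2 ∈ Metric.closedBall z.2 ε := by
    have h0 := (dist_bodyState_lt_iff hδ0).1 (Metric.mem_ball.1 hyδ)
    rw [← hγ0'] at h0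
    refine Metric.mem_closedBall.2 (le_trans (le_of_lt ?_) hδε)
    refine (dist_bodyState_lt_iff hδ0).2 ⟨fun i => ?_, fun i => ?_, fun i => ?_⟩
    · exact abs_sub_lt_of_abs_abs_sub_lt (f := fun t => (γ t).2.1 i) (by fun_prop) (hδ1 i)
        (fun t => (hγU t).1 i) (h0.1 i) t
    · exact abs_sub_lt_of_abs_abs_sub_lt (f := fun t => (γ t).2.2.1 i) (by fun_prop) (hδ2 i)
        (fun t => (hγU t).2.1 i) (h0.2.1 i) t
    · exact abs_sub_lt_of_abs_abs_sub_lt (f := fun t => (γ t).2.2.2 i) (by fun_prop) (hδ3 i)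
        (fun t => (hγU t).2.2 i) (h0.2.2 i) t
  have hEγ (t : ℝ) : E (γ t).2 = E y := by
    have hd (t : ℝ) : HasDerivAt (fun s => E (γ s).2) 0 t := by
      obtain ⟨h1, h2⟩ := (hεall (hstay t)).1
      exact (h1.hasFDerivAt.comp_hasDerivAt t (hγ t).2.1).congr_deriv h2
    rw [← hγ0']
    exact is_const_of_deriv_eq_zero (fun t => (hd t).differentiableAt) (fun t => (hd t).deriv) t 0
  have hFd (t : ℝ) : HasDerivAt (fun s => F (γ s).2)
      (fderiv ℝ F (γ t).2 (bodyField I (γ t).2)) t :=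
    ((hεall (hstay t)).2.1.hasFDerivAt.comp_hasDerivAt t (hγ t).2.1)
  set η := κ * (E z.2 - E y) with hη
  have hη0 : 0 < η := mul_pos hκ (by linarith)
  have hgrow (t : ℝ) (ht : 0 ≤ t) : η * t ≤ F (γ t).2 - F (γ 0).2 := by
    have := mul_sub_le_image_sub_of_le_deriv (f := fun s => F (γ s).2) (C := η)
      (fun t => (hFd t).differentiableAt) (fun t => ?_) ht
    · simpa using this
    · rw [(hFd t).deriv, hη, ← hEγ t]
      exact (hεall (hstay t)).2.2
  -- but `F` is bounded on the ball
  obtain ⟨C, hC⟩ := (isCompact_closedBall z.2 ε).exists_bound_of_continuousOn (f := F)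
    fun y hy => (hεall hy).2.1.continuousAt.continuousWithinAt
  have hC0 : 0 ≤ C := (norm_nonneg _).trans (hC _ (hstay 0))
  have h1 := hgrow ((2 * C + 1) / η) (by positivity)
  rw [mul_div_cancel₀ _ hη0.ne'] at h1
  have h2 := (abs_le.1 (hC _ (hstay ((2 * C + 1) / η)))).2
  have h3 := (abs_le.1 (hC _ (hstay 0))).1
  linarith

/-! ### The growing mode -/

/-- The squared growth rate `s` of the unstable mode, and the coefficient `A` of its left
eigenfunctional, in terms of the radial curvature `β`, the librational stiffness `δ` and
`c = r² / I₀`. -/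
theorem exists_growth_rate {β δ c w : ℝ} (hw : w ≠ 0) (hδ : 0 < δ) (hc : 0 < c)
    (hneg : (1 + c) * β + w ^ 2 * (3 * c - 1) < 0) :
    ∃ s > 0, ∃ A, -β - w ^ 2 + A * w * (β + w ^ 2 + δ * (1 - c)) = s ∧
      2 * w - A * (2 * w ^ 2 + δ * (1 + c)) = s * A := by
  set b := β + w ^ 2 with hb
  set e := 2 * w ^ 2 + δ * (1 + c) with he
  have he0 : 0 < e := by positivity
  set k := δ * ((1 + c) * β + w ^ 2 * (3 * c - 1)) with hk
  have hk0 : k < 0 := mul_neg_of_pos_of_neg hδ hneg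
  -- `s` is the positive root of `s² + (b + e) s + k`
  set d := √((b + e) ^ 2 - 4 * k) with hd
  have hd2 : d ^ 2 = (b + e) ^ 2 - 4 * k := Real.sq_sqrt (by nlinarith [sq_nonneg (b + e)])
  have hdlt : b + e < d := Real.lt_sqrt_of_sq_lt (by linarith)
  set s := (d - (b + e)) / 2 with hs
  have hs0 : 0 < s := by linarith
  have hroot : s ^ 2 + (b + e) * s + k = 0 := by
    rw [hs]
    linear_combination (1 / 4) * hd2
  have hse : s + e ≠ 0 := by positivity
  refine ⟨s, hs0, 2 * w / (s + e), ?_, ?_⟩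
  · field_simp
    rw [hk, hb] at hroot
    linear_combination -hroot - (β + w ^ 2) * he
  · field_simp
    ring

/-- On the kernel of the unstable left eigenfunctional the radial form is positive. -/
theorem radialForm_pos_of_mode {β δ c w s A : ℝ} (hw : w ≠ 0) (hδ : 0 < δ) (hc : 0 < c)
    (hs : 0 < s) (h1 : -β - w ^ 2 + A * w * (β + w ^ 2 + δ * (1 - c)) = s)
    (h2 : 2 * w - A * (2 * w ^ 2 + δ * (1 + c)) = s * A) :
    0 < 1 + c - 2 * A * (w * (c - 1)) + A ^ 2 * (β + w ^ 2 * c) := by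
  set h := A * w with hh
  have e1 : 2 * w ^ 2 = h * (s + 2 * w ^ 2 + δ * (1 + c)) := by
    rw [hh]
    linear_combination w * h2
  have hw2 : 0 < w ^ 2 := by positivity
  have hpos : 0 < h := by
    refine pos_of_mul_pos_left (b := s + 2 * w ^ 2 + δ * (1 + c)) ?_ (by positivity)
    rw [← e1]
    positivity
  have e2 : w ^ 2 * (1 - h) = h * (s + δ * (1 + c)) / 2 := by linear_combination e1 / 2
  have hlt : 0 < 1 - h := by
    refine pos_of_mul_pos_right (a := w ^ 2) ?_ hw2.le
    rw [e2]
    positivity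
  have e3 : (β + w ^ 2) * (1 - h) = h * δ * (1 - c) - s := by linear_combination -h1
  refine pos_of_mul_pos_right (a := w ^ 2 * (1 - h)) ?_ (mul_pos hw2 hlt).le
  have key : w ^ 2 * (1 - h) * (1 + c - 2 * A * (w * (c - 1)) + A ^ 2 * (β + w ^ 2 * c)) =
      h / 2 * (s * (c * (1 - h) ^ 2 + (1 - h) * (1 + h))
        + δ * (c ^ 2 * (1 - h) ^ 2 + 2 * c * ((1 - h) * (1 + h)) + (1 + h) ^ 2)) := by
    have : w ^ 2 * (1 + c - 2 * A * (w * (c - 1)) + A ^ 2 * (β + w ^ 2 * c)) =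
        w ^ 2 * (c * (1 - h) ^ 2 + 1 + 2 * h - h ^ 2) + h ^ 2 * (β + w ^ 2) := by
      rw [hh]
      ring
    linear_combination (1 - h) * this + (c * (1 - h) ^ 2 + 1 + 2 * h - h ^ 2) * e2 + h ^ 2 * e3
  rw [key]
  positivity

/-- The linear functional `δR₁ + A δP₂ + B δΠ₀` on the body state space. -/
def modeFunctional (A B : ℝ) : BodyState →L[ℝ] ℝ :=
  (ContinuousLinearMap.proj 1).comp (ContinuousLinearMap.fst ℝ Vec3 (Vec3 × Vec3))
    + A • (ContinuousLinearMap.proj 2).comp ((ContinuousLinearMap.snd ℝ Vec3 Vec3).comp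
      (ContinuousLinearMap.snd ℝ Vec3 (Vec3 × Vec3)))
    + B • (ContinuousLinearMap.proj 0).comp ((ContinuousLinearMap.fst ℝ Vec3 Vec3).comp
      (ContinuousLinearMap.snd ℝ Vec3 (Vec3 × Vec3)))

theorem modeFunctional_apply (A B : ℝ) (v : BodyState) :
    modeFunctional A B v = v.1 1 + A * v.2.2 2 + B * v.2.1 0 := by
  simp [modeFunctional]

/-- The components of the linearized vector field that enter the planar modes. -/
theorem fderiv_bodyField_baseState {I : Fin 3 → ℝ} (hI : ∀ i, I i ≠ 0) {r w : ℝ} (hr : r ≠ 0)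
    (v : BodyState) :
    let L := fderiv ℝ (bodyField I) (baseState I r w)
    let o := (v.2.1 0 - r * v.2.2 2 - w * r * v.1 1) / I 0
    (L v).1 1 = v.2.2 1 + w * v.1 2 ∧ (L v).1 2 = v.2.2 2 - w * v.1 1 - r * o ∧
      (L v).2.1 0 = 0 ∧ (L v).2.2 1 = w * v.2.2 2 + w * r * o - hessV I |r| 1 * v.1 1 ∧
      (L v).2.2 2 = -(w * v.2.2 1) - hessV I |r| 2 * v.1 2 := by
  intro L o
  have h0 := hI 0
  simp only [L, o]
  rw [fderiv_bodyField_apply I (axis_ne_zero hr), omega_baseState hI]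
  simp only [baseState]
  rw [fderiv_gradV_axis I hr]
  refine ⟨?_, ?_, ?_, ?_, ?_⟩ <;>
    simp [cross_apply, linOmega, Matrix.vecHead, Matrix.vecTail] <;> ring

/-- In the unstable regime the linearization has a growing mode: a functional `u` with
`u ∘ L ∘ L = s u`, `s > 0`, on whose kernel the radial form is positive. -/
theorem exists_unstable_mode {I : Fin 3 → ℝ} (hI : ∀ i, 0 < I i) (h21 : I 1 < I 2)
    {r w : ℝ} (hr : r ≠ 0) (hw0 : w ≠ 0) (hw : w ^ 2 = freqSq I |r|) (hcrit : critPoly I |r| < 0) :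
    ∃ s > 0, ∃ A B, (∀ v, modeFunctional A B (fderiv ℝ (bodyField I) (baseState I r w)
        (fderiv ℝ (bodyField I) (baseState I r w) v)) = s * modeFunctional A B v) ∧
      ∀ p ≠ 0, 0 < radialForm I r w p (-(A * p)) := by
  have h0 := hI 0
  have hl : 0 < |r| := abs_pos.2 hr
  set δ := 3 * (I 2 - I 1) / |r| ^ 5 with hδ
  have hδ0 : 0 < δ := div_pos (by linarith) (by positivity)
  set c := r ^ 2 / I 0 with hc
  have hc0 : 0 < c := by positivity
  have hγ : hessV I |r| 2 = w ^ 2 + δ := by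
    rw [hw]
    simp [hessV, hδ]
  have hneg : (1 + c) * hessV I |r| 1 + w ^ 2 * (3 * c - 1) < 0 := by
    have h := radial_curvature_eq I hl
    rw [← hw, sq_abs] at h
    have h' : (1 + c) * hessV I |r| 1 + w ^ 2 * (3 * c - 1) =
        critPoly I |r| / (2 * |r| ^ 5) / I 0 := by
      rw [← h, hc]
      field_simp
    rw [h']
    exact div_neg_of_neg_of_pos (div_neg_of_neg_of_pos hcrit (by positivity)) h0
  obtain ⟨s, hs, A, e1, e2⟩ := exists_growth_rate hw0 hδ0 hc0 hneg
  have hT := radialForm_pos_of_mode hw0 hδ0 hc0 hs e1 e2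
  refine ⟨s, hs, A, r * A * δ / (I 0 * s), fun v => ?_, fun p hp => ?_⟩
  · obtain ⟨f1, f2, f3, f4, f5⟩ := fderiv_bodyField_baseState (w := w) (fun i => (hI i).ne') hr v
    obtain ⟨g1, -, g3, -, g5⟩ := fderiv_bodyField_baseState (w := w) (fun i => (hI i).ne') hr
      (fderiv ℝ (bodyField I) (baseState I r w) v)
    rw [modeFunctional_apply, modeFunctional_apply, g1, g3, g5, f2, f4, hγ]
    set o := (v.2.1 0 - r * v.2.2 2 - w * r * v.1 1) / I 0 with ho
    have ho' : r * o = r / I 0 * v.2.1 0 - c * v.2.2 2 - w * c * v.1 1 := by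
      rw [ho, hc]
      field_simp
    have hB : s * (r * A * δ / (I 0 * s)) = A * δ * (r / I 0) := by field_simp
    linear_combination v.1 1 * e1 + v.2.2 2 * e2 - v.2.1 0 * hB + A * δ * ho'
  · have : radialForm I r w p (-(A * p)) =
        p ^ 2 * (1 + c - 2 * A * (w * (c - 1)) + A ^ 2 * (hessV I |r| 1 + w ^ 2 * c)) := by
      simp only [radialForm, hc]
      ring
    rw [this]
    positivity

/-! ### Instability below the critical radius -/

theorem isLinearlyUnstable_of_critPoly_neg {I : Fin 3 → ℝ} (hI : ∀ i, 0 < I i) (h21 : I 1 < I 2)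
    {r w : ℝ} (hr : r ≠ 0) (hw0 : w ≠ 0) (hw : w ^ 2 = freqSq I |r|) (hcrit : critPoly I |r| < 0)
    {z : Phase} (hz : z.2 = baseState I r w) : IsLinearlyUnstable I z := by
  obtain ⟨s, hs, A, B, hmode, -⟩ := exists_unstable_mode hI h21 hr hw0 hw hcrit
  set L := fderiv ℝ (bodyField I) (baseState I r w) with hL
  set u := modeFunctional A B
  have hs' : √s * √s = s := Real.mul_self_sqrt hs.le
  -- the left eigenvector `√s u + u ∘ L` vanishes on the range of `L - √s`
  have hann (v : BodyState) : √s * u (L v - √s • v) + u (L (L v - √s • v)) = 0 := by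
    simp only [map_sub, map_smul, smul_eq_mul, hmode]
    linear_combination -(u v) * hs'
  have hnsurj : ¬ Function.Surjective (L - √s • ContinuousLinearMap.id ℝ BodyState) := by
    intro h
    obtain ⟨v, hv⟩ := h (![0, 1, 0], 0, 0)
    have h1 := hann v
    have hv' : L v - √s • v = (![0, 1, 0], 0, 0) := by simpa using hv
    rw [hv'] at h1
    obtain ⟨f1, -, f3, -, f5⟩ := fderiv_bodyField_baseState (w := w) (fun i => (hI i).ne') hr
      (![0, 1, 0], 0, 0)
    rw [modeFunctional_apply, modeFunctional_apply, f1, f3, f5] at h1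
    simp [hs.not_ge, Real.sqrt_eq_zero'] at h1
  refine ⟨((√s : ℝ) : ℂ), by simpa using hs, ?_⟩
  have hev : Module.End.HasEigenvalue (L : BodyState →ₗ[ℝ] BodyState) √s := by
    rw [Module.End.hasEigenvalue_iff, Module.End.eigenspace_def, Ne, LinearMap.ker_eq_bot]
    intro hinj
    refine hnsurj ?_
    exact LinearMap.injective_iff_surjective.1 hinj
  have hroot := (Module.End.hasEigenvalue_iff_isRoot_charpoly _ _).1 hev
  rw [hz, ← hL]
  have := Polynomial.aeval_algebraMap_apply_eq_algebraMap_eval (A := ℂ) (√s)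
    (L : BodyState →ₗ[ℝ] BodyState).charpoly
  rw [Polynomial.IsRoot.def.1 hroot, map_zero] at this
  exact this

/-- For the function `F = u · (u ∘ L)` of the growing mode `u`, the derivative `F'` dominates the
energy deficit; the energy has no minimum because the radial form is indefinite. -/
theorem not_isStable_of_critPoly_neg {I : Fin 3 → ℝ} (hI : ∀ i, 0 < I i) (h02 : I 2 < I 0)
    (h21 : I 1 < I 2) {r w : ℝ} (hr : r ≠ 0) (hw0 : w ≠ 0) (hw : w ^ 2 = freqSq I |r|)
    (hcrit : critPoly I |r| < 0) {z : Phase} (hz : z.2 = baseState I r w) : ¬ IsStable I z := by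
  obtain ⟨s, hs, A, B, hmode, hTpos⟩ := exists_unstable_mode hI h21 hr hw0 hw hcrit
  have h0 := hI 0
  have hl : 0 < |r| := abs_pos.2 hr
  set L := fderiv ℝ (bodyField I) (baseState I r w) with hL
  set u := modeFunctional A B with hu
  set a := I 0 + r ^ 2 with ha
  have haw : a * w ≠ 0 := mul_ne_zero (by positivity) hw0
  have hR0 : (baseState I r w).1 ≠ 0 := axis_ne_zero hr
  have hR : z.2.1 ≠ 0 := by rw [hz]; exact hR0
  -- the second variation is positive where the rate of change of `u (u ∘ L)` vanishes
  obtain ⟨N, hN, c, hc, hq⟩ := exists_add_mul_ge_norm_sq (continuous_secondVariation I r w)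
    (g := fun v : BodyState => 8 * (a * w) ^ 2 * v.2.1 0 ^ 2 + (u (L v) ^ 2 + s * u v ^ 2))
    (by fun_prop) (secondVariation_smul I r w)
    (fun t v => by
      simp only [map_smul, Prod.smul_snd, Prod.smul_fst, Pi.smul_apply, smul_eq_mul]
      ring)
    (fun v => by positivity) (fun v hv hv0 => by
      have n1 : 0 ≤ 8 * (a * w) ^ 2 * v.2.1 0 ^ 2 := by positivity
      have n2 : 0 ≤ u (L v) ^ 2 := sq_nonneg _
      have n3 : 0 ≤ s * u v ^ 2 := by positivity
      have z1 : 8 * (a * w) ^ 2 * v.2.1 0 ^ 2 = 0 := by linarith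
      have z3 : s * u v ^ 2 = 0 := by linarith
      have hv1 : v.2.1 0 = 0 := by simpa [haw] using z1
      have hv2 : v.1 1 = -(A * v.2.2 2) := by
        have : u v = 0 := by simpa [hs.ne'] using z3
        rw [hu, modeFunctional_apply, hv1] at this
        linarith
      refine secondVariation_pos hI h02 h21 hr hw0 hw hv hv1 fun h => ?_
      rw [hv2]
      refine hTpos _ fun h' => ?_
      simp [hv2, h'] at h)
  set E := energy I a ((a * w) ^ 2) N with hE
  have hE1 : fderiv ℝ E (baseState I r w) = 0 := fderiv_energy_baseState hI hr hw N
  have hE2 (v : BodyState) : fderiv ℝ (fderiv ℝ E) (baseState I r w) v v =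
      secondVariation I r w v + N * (8 * (a * w) ^ 2 * v.2.1 0 ^ 2) :=
    fderiv_fderiv_energy_baseState hI hr N v
  have ht := isLittleO_taylor_two (contDiffAt_energy I a ((a * w) ^ 2) N hR0)
  simp only [← hE, hE1, hE2, zero_apply, sub_zero] at ht
  let F : BodyState → ℝ := fun y => u (y - baseState I r w) * u (L (y - baseState I r w))
  have hFd (y : BodyState) : HasFDerivAt F (u (y - baseState I r w) • (u.comp L)
      + u (L (y - baseState I r w)) • u) y := by
    have hid : HasFDerivAt (fun y => y - baseState I r w) (ContinuousLinearMap.id ℝ BodyState) y :=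
      (hasFDerivAt_id y).sub_const _
    exact (u.hasFDerivAt.comp y hid).mul ((u.comp L).hasFDerivAt.comp y hid)
  refine not_isStable_of_deficit (E := E) (F := F) (κ := 2 / N) (by positivity) ?_ ?_ ?_
  · filter_upwards [isOpen_fst_ne_zero.eventually_mem hR] with y hy
    exact ⟨(contDiffAt_energy I a _ N hy).differentiableAt (by norm_num),
      fderiv_energy_bodyField I a _ N hy⟩
  · set K := ‖u‖ + ‖u.comp L‖ with hK
    have hX : HasFDerivAt (bodyField I) L (baseState I r w) :=
      ((contDiffAt_bodyField I hR0).differentiableAt (by norm_num)).hasFDerivAt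
    have hX0 : bodyField I (baseState I r w) = 0 := bodyField_baseState (fun i => (hI i).ne') hr hw
    have h1 := ht.def (show 0 < c / 4 by positivity)
    have h2 := hX.isLittleO.def (show 0 < c / (4 * N * (K ^ 2 + 1)) by positivity)
    rw [hz]
    filter_upwards [h1, h2] with y h1 h2
    refine ⟨(hFd y).differentiableAt, ?_⟩
    rw [(hFd y).fderiv]
    rw [hX0, sub_zero] at h2
    set v := y - baseState I r w with hv
    set e := bodyField I y - L v with he
    have hXe : bodyField I y = L v + e := by rw [he]; abel
    rw [hXe]
    simp only [add_apply, smul_apply,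
      ContinuousLinearMap.comp_apply, smul_eq_mul, map_add, hmode]
    have hu1 (x : BodyState) : |u x| ≤ K * ‖x‖ := (u.le_opNorm x).trans (by
      gcongr; rw [hK]; exact le_add_of_nonneg_right (norm_nonneg _))
    have hu2 (x : BodyState) : |u (L x)| ≤ K * ‖x‖ := ((u.comp L).le_opNorm x).trans (by
      gcongr; rw [hK]; exact le_add_of_nonneg_left (norm_nonneg _))
    have hK0 : 0 ≤ K := by positivity
    have herr : |u v * u (L e) + u (L v) * u e| ≤ c / (2 * N) * ‖v‖ ^ 2 := by
      calc |u v * u (L e) + u (L v) * u e|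
          ≤ |u v| * |u (L e)| + |u (L v)| * |u e| := by
            rw [← abs_mul, ← abs_mul]
            exact abs_add_le _ _
        _ ≤ (K * ‖v‖) * (K * ‖e‖) + (K * ‖v‖) * (K * ‖e‖) := by
            gcongr <;> first | exact hu1 _ | exact hu2 _
        _ = 2 * K ^ 2 * ‖v‖ * ‖e‖ := by ring
        _ ≤ 2 * (K ^ 2 + 1) * ‖v‖ * (c / (4 * N * (K ^ 2 + 1)) * ‖v‖) := by
            gcongr
            linarith
        _ = c / (2 * N) * ‖v‖ ^ 2 := by
            field_simp
            ring
    have h3 := (abs_le.1 herr).1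
    have h4 := (abs_le.1 h1).1
    rw [norm_pow, norm_norm] at h4
    have h5 := hq v
    have h6 : E (baseState I r w) - E y ≤
        N / 2 * (u (L v) ^ 2 + s * u v ^ 2) - c / 4 * ‖v‖ ^ 2 := by linarith
    calc 2 / N * (E (baseState I r w) - E y)
        ≤ 2 / N * (N / 2 * (u (L v) ^ 2 + s * u v ^ 2) - c / 4 * ‖v‖ ^ 2) := by gcongr
      _ = u (L v) ^ 2 + s * u v ^ 2 - c / (2 * N) * ‖v‖ ^ 2 := by
          field_simp
          ring
      _ ≤ _ := by linarith
  · -- the energy decreases along the negative direction of the radial form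
    set A' := 1 + r ^ 2 / I 0 with hA'
    set B' := w * (r ^ 2 / I 0 - 1) with hB'
    have hA'0 : 0 < A' := by positivity
    set v : BodyState := (![0, 1, 0], 0, ![0, 0, -B' / A']) with hv
    have hQ : secondVariation I r w v < 0 := by
      have h1 : secondVariation I r w v = radialForm I r w (-B' / A') 1 := by
        simp [secondVariation, radialForm, hv]
        ring
      have h2 : radialForm I r w (-B' / A') 1 = critPoly I |r| / (2 * |r| ^ 5 * I 0) / A' := by
        rw [← radialForm_det h0 hr hw, radialForm, ← hA', ← hB']
        field_simp
        ring
      rw [h1, h2]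
      exact div_neg_of_neg_of_pos (div_neg_of_neg_of_pos hcrit (by positivity)) hA'0
    have hlim : Filter.Tendsto (fun t : ℝ => baseState I r w + t • v) (𝓝[≠] 0)
        (𝓝 (baseState I r w)) := by
      have : Continuous fun t : ℝ => baseState I r w + t • v := by fun_prop
      simpa using (this.tendsto 0).mono_left nhdsWithin_le_nhds
    rw [hz]
    refine hlim.frequently (Filter.Eventually.frequently ?_)
    have h1 := hlim.eventually (ht.def (show 0 < -secondVariation I r w v / (4 * (‖v‖ ^ 2 + 1)) from
      div_pos (by linarith) (by positivity)))
    filter_upwards [h1, self_mem_nhdsWithin] with t h1 ht0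
    have ht2 : 0 < t ^ 2 := by
      have : t ≠ 0 := ht0
      positivity
    rw [add_sub_cancel_left, secondVariation_smul, norm_pow, norm_norm, norm_smul] at h1
    have h2 := (abs_le.1 h1).2
    have h3 : (t • v).2.1 0 = 0 := by simp [hv]
    have h4 : -secondVariation I r w v / (4 * (‖v‖ ^ 2 + 1)) * (‖t‖ * ‖v‖) ^ 2 ≤
        t ^ 2 * (-secondVariation I r w v / 4) := by
      rw [mul_pow, Real.norm_eq_abs, sq_abs]
      calc -secondVariation I r w v / (4 * (‖v‖ ^ 2 + 1)) * (t ^ 2 * ‖v‖ ^ 2)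
          = t ^ 2 * (-secondVariation I r w v / 4) * (‖v‖ ^ 2 / (‖v‖ ^ 2 + 1)) := by
            field_simp
        _ ≤ t ^ 2 * (-secondVariation I r w v / 4) * 1 := by
            have : 0 < -secondVariation I r w v / 4 := by linarith
            gcongr
            exact div_le_one_of_le₀ (by linarith) (by positivity)
        _ = _ := mul_one _
    rw [h3] at h2
    have h5 : t ^ 2 * secondVariation I r w v < 0 := mul_neg_of_pos_of_neg ht2 hQ
    linarith

/-! ### Relative equilibria near the family -/

/-- The relative equilibrium equations force an almost orthogonal solution to be orthogonal. Here `R`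
and `o` are the position and the body angular velocity, `σ = R ⬝ o`, `D = 1 / |R| ^ 5`, and
`R i * (g + 3 I i D)` are the components of `∇V₂(R) - |o|² R`. The equation for `i = 1` determines
`g`, and what remains of the coefficients for `i = 0, 2` is `κ₀`, `κ₂`. -/
theorem orthogonal_of_relEq_equations {I R o : Vec3} {g D σ κ₀ κ₂ : ℝ}
    (hσ : σ = R 0 * o 0 + R 1 * o 1 + R 2 * o 2)
    (e : ∀ i, R i * (g + 3 * I i * D) + σ * o i = 0)
    (t1 : (I 0 - I 2) * o 0 * o 2 + σ * (R 2 * o 0 - R 0 * o 2) = 0)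
    (t2 : (I 1 - I 0) * o 0 * o 1 - σ * (R 1 * o 0 - R 0 * o 1) = 0) (hR1 : R 1 ≠ 0)
    (hκ₀ : κ₀ = 3 * (I 0 - I 1) * D - σ * o 1 / R 1)
    (hκ₂ : κ₂ = 3 * (I 2 - I 1) * D - σ * o 1 / R 1) (hκ₀' : 0 < κ₀) (hκ₂' : 0 < κ₂)
    (hb₁ : 0 < ((I 0 - I 1) * o 0 - σ * R 0) * o 0)
    (hb₂ : 0 < ((I 0 - I 2) * o 0 - σ ^ 2 * o 0 / κ₂ - σ * R 0) * o 0) :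
    R 0 = 0 ∧ R 2 = 0 ∧ o 1 = 0 ∧ o 2 = 0 := by
  have ho : o 0 ≠ 0 := right_ne_zero_of_mul hb₁.ne'
  have hg : g = -3 * I 1 * D - σ * o 1 / R 1 := by
    field_simp
    linear_combination e 1
  have r0 : R 0 * κ₀ = -(σ * o 0) := by
    rw [hκ₀]
    linear_combination e 0 - R 0 * hg
  have r2 : R 2 * κ₂ = -(σ * o 2) := by
    rw [hκ₂]
    linear_combination e 2 - R 2 * hg
  have ho2 : o 2 = 0 := by
    have : o 2 * ((I 0 - I 2) * o 0 - σ ^ 2 * o 0 / κ₂ - σ * R 0) = 0 := by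
      have r2' : R 2 = -(σ * o 2) / κ₂ := by
        rw [← r2]
        field_simp
      rw [r2'] at t1
      linear_combination t1
    exact (mul_eq_zero.1 this).resolve_right (left_ne_zero_of_mul hb₂.ne')
  have hR2 : R 2 = 0 := by
    rw [ho2, mul_zero, neg_zero] at r2
    exact (mul_eq_zero.1 r2).resolve_right hκ₂'.ne'
  -- all contributions to `R ⬝ o` have the sign opposite to `R ⬝ o`
  have hσ0 : σ = 0 := by
    set b := (I 0 - I 1) * o 0 - σ * R 0 with hb
    have o1 : o 1 * b = -(σ * R 1 * o 0) := by
      rw [hb]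
      linear_combination -t2
    have : σ * (κ₀ * (b * o 0) + o 0 ^ 2 * (b * o 0) + R 1 ^ 2 * o 0 ^ 2 * κ₀) = 0 := by
      rw [ho2] at hσ
      linear_combination κ₀ * (b * o 0) * hσ + b * o 0 ^ 2 * r0 + R 1 * o 0 * κ₀ * o1
    refine (mul_eq_zero.1 this).resolve_right (ne_of_gt ?_)
    positivity
  refine ⟨?_, hR2, ?_, ho2⟩
  · rw [hσ0, zero_mul, neg_zero] at r0
    exact (mul_eq_zero.1 r0).resolve_right hκ₀'.ne'
  · rw [hσ0, zero_mul, sub_zero] at t2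
    have h : I 1 - I 0 ≠ 0 := by
      intro h
      rw [hσ0, zero_mul, sub_zero] at hb₁
      have : I 0 - I 1 = 0 := by linarith
      simp [this] at hb₁
    exact (mul_eq_zero.1 t2).resolve_left (mul_ne_zero h ho)

/-- All quantities that `orthogonal_of_relEq_equations` requires to be positive are continuous, and
positive on the family by the Lagrange conditions. -/
theorem not_isBifurcationPoint {I : Fin 3 → ℝ} (hI : ∀ i, 0 < I i) (h02 : I 2 < I 0)
    (h21 : I 1 < I 2) {r w : ℝ} (hr : r ≠ 0) (hw0 : w ≠ 0) {z : Phase}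
    (hz : z.2 = baseState I r w) : ¬ IsBifurcationPoint I (orthFamily I) z := by
  have hI' (i : Fin 3) : I i ≠ 0 := (hI i).ne'
  have hl : 0 < |r| := abs_pos.2 hr
  let σ : BodyState → ℝ := fun y => y.1 0 * omega I y 0 + y.1 1 * omega I y 1 + y.1 2 * omega I y 2
  let κ : Fin 3 → BodyState → ℝ := fun i y =>
    3 * (I i - I 1) * (1 / len y.1 ^ 5) - σ y * omega I y 1 / y.1 1
  let b₁ : BodyState → ℝ := fun y => ((I 0 - I 1) * omega I y 0 - σ y * y.1 0) * omega I y 0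
  let b₂ : BodyState → ℝ := fun y =>
    ((I 0 - I 2) * omega I y 0 - σ y ^ 2 * omega I y 0 / κ 2 y - σ y * y.1 0) * omega I y 0
  have hR0 : (baseState I r w).1 ≠ 0 := axis_ne_zero hr
  have ho (i : Fin 3) : ContinuousAt (fun y => omega I y i) (baseState I r w) :=
    ((continuous_apply i).comp (contDiff_omega I).continuous).continuousAt
  have hσ : ContinuousAt σ (baseState I r w) := by
    have := ho 0; have := ho 1; have := ho 2
    fun_prop
  have hlen : ContinuousAt (fun y : BodyState => len y.1) (baseState I r w) :=
    (contDiffAt_len hR0).continuousAt.comp continuousAt_fst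
  have hκ (i : Fin 3) : ContinuousAt (κ i) (baseState I r w) := by
    refine ContinuousAt.sub (continuousAt_const.mul (continuousAt_const.div (hlen.pow 5) ?_))
      ((hσ.mul (ho 1)).div (by fun_prop) ?_)
    · exact pow_ne_zero _ (len_pos hR0).ne'
    · simpa [baseState] using hr
  have hσ0 : σ (baseState I r w) = 0 := by
    simp only [σ, omega_baseState hI']
    simp [baseState]
  have hκ0 (i : Fin 3) : κ i (baseState I r w) = 3 * (I i - I 1) * (1 / |r| ^ 5) := by
    simp [κ, hσ0, len_baseState]
  have hκpos {i : Fin 3} (h : I 1 < I i) : 0 < κ i (baseState I r w) := by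
    rw [hκ0]
    have : 0 < I i - I 1 := by linarith
    positivity
  have hb₁ : ContinuousAt b₁ (baseState I r w) := by
    have := ho 0
    fun_prop
  have hb₂ : ContinuousAt b₂ (baseState I r w) := by
    have := ho 0
    refine ContinuousAt.mul (ContinuousAt.sub (ContinuousAt.sub (by fun_prop)
      (((hσ.pow 2).mul this).div (hκ 2) (hκpos h21).ne')) (by fun_prop)) this
  have hw2 : 0 < w * w := mul_self_pos.2 hw0
  have hb₁0 : 0 < b₁ (baseState I r w) := by
    have : b₁ (baseState I r w) = (I 0 - I 1) * (w * w) := by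
      simp [b₁, hσ0, omega_baseState hI']
      ring
    rw [this]
    exact mul_pos (by linarith) hw2
  have hb₂0 : 0 < b₂ (baseState I r w) := by
    have : b₂ (baseState I r w) = (I 0 - I 2) * (w * w) := by
      simp [b₂, hσ0, omega_baseState hI']
      ring
    rw [this]
    exact mul_pos (by linarith) hw2
  have hR1 : ∀ᶠ y : BodyState in 𝓝 (baseState I r w), y.1 1 ≠ 0 := by
    have : ContinuousAt (fun y : BodyState => y.1 1) (baseState I r w) := by fun_prop
    exact this.eventually_ne (by simpa [baseState] using hr)
  have hev := ((hR1.and (((hκ 0).eventually (lt_mem_nhds (hκpos (h21.trans h02)))).and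
    ((hκ 2).eventually (lt_mem_nhds (hκpos h21))))).and
    ((hb₁.eventually (lt_mem_nhds hb₁0)).and (hb₂.eventually (lt_mem_nhds hb₂0))))
  rw [← hz] at hev
  intro hbif
  obtain ⟨x, hx, ⟨ξ, hξ⟩, hxF⟩ := hbif _ ((continuous_snd (X := SO3)).continuousAt.eventually hev)
  obtain ⟨⟨hx1, hx2, hx3⟩, hx4, hx5⟩ := hx
  obtain ⟨h0, h1, h2⟩ := isRelEq_iff.1 hξ
  obtain ⟨e1, e2, e3⟩ := (bodyField_eq_zero_iff h0).1 h1
  have hQ := momentum_eq_of_omega hI' x.2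
  have hgV (i : Fin 3) : gradV I x.2.1 i = x.2.1 i * (1 / len x.2.1 ^ 3 + 3 / (2 * len x.2.1 ^ 5)
    - 15 / (2 * len x.2.1 ^ 7) * (x.2.1 ⬝ᵥ inertia I x.2.1) + 3 * I i / len x.2.1 ^ 5) := rfl
  set f := 1 / len x.2.1 ^ 3 + 3 / (2 * len x.2.1 ^ 5)
    - 15 / (2 * len x.2.1 ^ 7) * (x.2.1 ⬝ᵥ inertia I x.2.1)
  set o := omega I x.2 with ho'
  rw [e1] at hQ e3
  have hQ0 := hQ 0; have hQ1 := hQ 1; have hQ2 := hQ 2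
  have e20 := congrFun e2 0; have e21 := congrFun e2 1; have e22 := congrFun e2 2
  have e30 := congrFun e3 0; have e31 := congrFun e3 1; have e32 := congrFun e3 2
  simp only [cross_apply, Matrix.cons_val, Pi.add_apply, Pi.zero_apply, hgV]
    at hQ0 hQ1 hQ2 e20 e21 e22 e30 e31 e32
  rw [hQ0, hQ2] at e21
  rw [hQ0, hQ1] at e22
  obtain ⟨c0, c2, c3, c4⟩ := orthogonal_of_relEq_equations (I := I) (R := x.2.1) (o := o)
    (g := f - (o 0 ^ 2 + o 1 ^ 2 + o 2 ^ 2)) (D := 1 / len x.2.1 ^ 5) (σ := σ x.2) rfl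
    (fun i => by
      simp only [σ, ← ho']
      fin_cases i <;> simp only [Fin.zero_eta, Fin.mk_one, Fin.reduceFinMk]
      · linear_combination e30
      · linear_combination e31
      · linear_combination e32)
    (by simp only [σ, ← ho']; linear_combination -e21)
    (by simp only [σ, ← ho']; linear_combination -e22) hx1 rfl rfl hx2 hx3 hx4 hx5
  refine hxF ⟨ξ, hξ, ?_, ⟨c0, c2⟩, ?_, ?_⟩
  · rw [h2, IsOrthogonal, Matrix.dotProduct_mulVec, ← Matrix.mulVec_transpose,
      SO3.transpose_mulVec_mulVec]
    simp [dotProduct, Fin.sum_univ_three, c0, c2, c3]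
  · rw [h2, SO3.transpose_mulVec_mulVec]
    exact c3
  · rw [h2, SO3.transpose_mulVec_mulVec]
    exact c4

/-! ### Nondegeneracy of the relative equilibrium equations -/

theorem contDiffAt_relEqMap (I : Fin 3 → ℝ) {y : Vec3 × Vec3} (hR : y.1 ≠ 0) :
    ContDiffAt ℝ 1 (relEqMap I) y := by
  have hopen : IsOpen {y : Vec3 × Vec3 | y.1 ≠ 0} := isOpen_ne_fun continuous_fst continuous_const
  have h : relEqMap I =ᶠ[𝓝 y] fun y =>
      (y.2 ⨯₃ (inertia I y.2 - (y.1 ⬝ᵥ y.2) • y.1 + (y.1 ⬝ᵥ y.1) • y.2),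
        gradV I y.1 + (y.1 ⬝ᵥ y.2) • y.2 - (y.2 ⬝ᵥ y.2) • y.1) :=
    (hopen.eventually_mem hR).mono fun x hx => by rw [relEqMap, gradPotential_eq I hx]
  have hg : ContDiffAt ℝ 1 (fun y : Vec3 × Vec3 => gradV I y.1) y :=
    ((contDiffAt_gradV I hR).of_le (by norm_num)).comp y contDiffAt_fst
  refine ContDiffAt.congr_of_eventuallyEq ?_ h
  simp only [dotProduct, Fin.sum_univ_three]
  refine (contDiffAt_snd.crossProduct ?_).prodMk (by fun_prop)
  unfold inertia
  fun_prop

theorem fderiv_relEqMap_apply (I : Fin 3 → ℝ) {y : Vec3 × Vec3} (hR : y.1 ≠ 0) (v : Vec3 × Vec3) :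
    fderiv ℝ (relEqMap I) y v =
      (v.2 ⨯₃ (inertia I y.2 - (y.1 ⬝ᵥ y.2) • y.1 + (y.1 ⬝ᵥ y.1) • y.2)
        + y.2 ⨯₃ (inertia I v.2 - ((y.1 ⬝ᵥ y.2) • v.1 + (v.1 ⬝ᵥ y.2 + y.1 ⬝ᵥ v.2) • y.1)
          + ((y.1 ⬝ᵥ y.1) • v.2 + (v.1 ⬝ᵥ y.1 + y.1 ⬝ᵥ v.1) • y.2)),
        fderiv ℝ (gradV I) y.1 v.1
          + ((y.1 ⬝ᵥ y.2) • v.2 + (v.1 ⬝ᵥ y.2 + y.1 ⬝ᵥ v.2) • y.2)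
          - ((y.2 ⬝ᵥ y.2) • v.1 + (v.2 ⬝ᵥ y.2 + y.2 ⬝ᵥ v.2) • y.1)) := by
  rw [← ((contDiffAt_relEqMap I hR).differentiableAt (by norm_num)).lineDeriv_eq_fderiv]
  have hc : HasDerivAt (fun t : ℝ => y + t • v) v 0 := by
    simpa using ((hasDerivAt_id (0 : ℝ)).smul_const v).const_add y
  have h1 : HasDerivAt (fun t : ℝ => (y + t • v).1) v.1 0 := hc.fst
  have h2 : HasDerivAt (fun t : ℝ => (y + t • v).2) v.2 0 := hc.snd
  have hi : HasDerivAt (fun t : ℝ => inertia I (y + t • v).2) (inertia I v.2) 0 :=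
    hasDerivAt_pi.2 fun i => (hasDerivAt_pi.1 h2 i).const_mul (I i)
  have hg : HasDerivAt (fun t : ℝ => gradV I (y + t • v).1) (fderiv ℝ (gradV I) y.1 v.1) 0 :=
    ((contDiffAt_gradV I hR).differentiableAt (by norm_num)).hasFDerivAt.hasLineDerivAt v.1
  have key := (h2.crossProduct ((hi.sub ((h1.dotProduct h2).smul h1)).add
    ((h1.dotProduct h1).smul h2))).prodMk ((hg.add ((h1.dotProduct h2).smul h2)).sub
    ((h2.dotProduct h2).smul h1))
  have hopen : IsOpen {y : Vec3 × Vec3 | y.1 ≠ 0} := isOpen_ne_fun continuous_fst continuous_const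
  have hnear := hc.continuousAt.eventually_mem (hopen.mem_nhds (by simpa using hR))
  refine HasDerivAt.deriv (HasDerivAt.congr_of_eventuallyEq (key.congr_deriv (by simp))
    (hnear.mono fun t ht => ?_))
  simp only [relEqMap]
  rw [gradPotential_eq I ht]
  rfl

theorem relEqJacobian_axis (I : Fin 3 → ℝ) {r : ℝ} (hr : r ≠ 0) (w : ℝ) :
    relEqJacobian I (![0, r, 0], ![w, 0, 0]) =
      !![0, 0, (I 0 - I 2) * w, 0, 0;
        0, -((I 0 + r ^ 2 - I 1) * w), 0, -(r * w ^ 2), 0;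
        0, r * w, 0, hessV I |r| 0, 0;
        -(2 * w * r), 0, 0, 0, 0;
        0, 0, 0, 0, hessV I |r| 2 - w ^ 2] := by
  set y : Vec3 × Vec3 := (![0, r, 0], ![w, 0, 0]) with hy
  have hR : y.1 ≠ 0 := axis_ne_zero hr
  have hd := ((contDiffAt_relEqMap I hR).differentiableAt (by norm_num)).hasFDerivAt
  have h1 (i : Fin 3) (v : Vec3 × Vec3) :
      fderiv ℝ (fun x => (relEqMap I x).1 i) y v = (fderiv ℝ (relEqMap I) y v).1 i := by
    rw [((hasFDerivAt_pi'.1 hd.fst) i).fderiv]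
    rfl
  have h2 (i : Fin 3) (v : Vec3 × Vec3) :
      fderiv ℝ (fun x => (relEqMap I x).2 i) y v = (fderiv ℝ (relEqMap I) y v).2 i := by
    rw [((hasFDerivAt_pi'.1 hd.snd) i).fderiv]
    rfl
  have h3 (v : Vec3 × Vec3) := fderiv_relEqMap_apply I hR v
  rw [hy] at h3
  simp only [fderiv_gradV_axis I hr] at h3
  rw [← hy] at h3
  ext i j
  fin_cases i <;> simp only [relEqJacobian, Matrix.of_apply, Fin.zero_eta, Fin.mk_one,
      Fin.reduceFinMk, Matrix.cons_val, h1, h2] <;>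
    fin_cases j <;>
    simp [h3, cross_apply, inertia, dotProduct, Fin.sum_univ_three, Matrix.vecHead, Matrix.vecTail] <;>
    first | ring1 | exact Or.inl (by ring)

theorem det_relEqJacobian_axis_ne_zero {I : Fin 3 → ℝ} (h02 : I 2 < I 0)
    (h21 : I 1 < I 2) {r w : ℝ} (hr : r ≠ 0) (hw0 : w ≠ 0) (hw : w ^ 2 = freqSq I |r|) :
    (relEqJacobian I (![0, r, 0], ![w, 0, 0])).det ≠ 0 := by
  have hl : 0 < |r| := abs_pos.2 hr
  have hdet : (relEqJacobian I (![0, r, 0], ![w, 0, 0])).det =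
      2 * ((I 0 - I 2) * w * (w * r) * w * (hessV I |r| 2 - w ^ 2)
        * ((I 0 + r ^ 2 - I 1) * hessV I |r| 0 - r ^ 2 * w ^ 2)) := by
    rw [relEqJacobian_axis I hr]
    simp [Matrix.det_succ_row_zero, Fin.sum_univ_succ, Fin.succAbove]
    ring
  have hα : w ^ 2 < hessV I |r| 0 := by
    have : 0 < 3 * (I 0 - I 1) / |r| ^ 5 := div_pos (by linarith) (by positivity)
    simp only [hessV, Matrix.cons_val, ← hw]
    linarith
  have hγ : w ^ 2 < hessV I |r| 2 := by
    have : 0 < 3 * (I 2 - I 1) / |r| ^ 5 := div_pos (by linarith) (by positivity)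
    simp only [hessV, Matrix.cons_val, ← hw]
    linarith
  have hw2 : 0 < w ^ 2 := by positivity
  have hr2 : 0 < r ^ 2 := by positivity
  have h5 : r ^ 2 * w ^ 2 < (I 0 + r ^ 2 - I 1) * hessV I |r| 0 :=
    mul_lt_mul'' (by linarith) hα hr2.le hw2.le
  have e1 : I 0 - I 2 ≠ 0 := by linarith
  have e2 : hessV I |r| 2 - w ^ 2 ≠ 0 := by linarith
  have e3 : (I 0 + r ^ 2 - I 1) * hessV I |r| 0 - r ^ 2 * w ^ 2 ≠ 0 := by linarith
  rw [hdet]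
  positivity

/-- The critical polynomial, quadratic in `l²`, has a negative constant term because `I 1 < 1 / 3`;
hence it changes sign exactly once on the positive axis. -/
theorem exists_critical_radius {I : Fin 3 → ℝ} (hI : ∀ i, 0 < I i) (hI0 : I 0 < 1 / 2)
    (hI1 : I 1 < 1 / 3) :
    ∃ R, 0 < R ∧ R < 2 ∧ critPoly I R = 0 ∧ (∀ l, R < l → 0 < critPoly I l) ∧
      ∀ l, 0 < l → l < R → critPoly I l < 0 := by
  have h0 := hI 0
  have h1 := hI 1
  have hk : 0 < 15 * I 0 * (1 - 3 * I 1) := mul_pos (by positivity) (by linarith)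
  have hcont : ContinuousOn (critPoly I) (Set.Icc 0 2) := by
    unfold critPoly
    fun_prop
  obtain ⟨R, ⟨hR0, hR2⟩, hR⟩ := intermediate_value_Ioo (zero_le_two (α := ℝ)) hcont
    (show (0 : ℝ) ∈ Set.Ioo (critPoly I 0) (critPoly I 2) by
      have := mul_pos h0 h1
      constructor <;> simp only [critPoly] <;> nlinarith)
  -- the other root in `l²` is found from the product of the roots
  have hfac (l : ℝ) : R ^ 2 * critPoly I l =
      (l ^ 2 - R ^ 2) * (2 * l ^ 2 * R ^ 2 + 15 * I 0 * (1 - 3 * I 1)) := by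
    simp only [critPoly] at hR ⊢
    linear_combination l ^ 2 * hR
  have hR2' : 0 < R ^ 2 := by positivity
  refine ⟨R, hR0, hR2, hR, fun l hl => ?_, fun l hl0 hl => ?_⟩
  · refine pos_of_mul_pos_right (a := R ^ 2) ?_ hR2'.le
    rw [hfac]
    exact mul_pos (by nlinarith) (by positivity)
  · have : R ^ 2 * critPoly I l < 0 := by
      rw [hfac]
      exact mul_neg_of_neg_of_pos (by nlinarith) (by positivity)
    exact neg_of_mul_neg_right this hR2'.le

end Satellite

end

theorem mainTheorem3 (I : Fin 3 → ℝ) (hpos : ∀ i, 0 < I i) (htri : ∀ i, I i < 1 / 2)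
    (htrace : I 0 + I 1 + I 2 = 1) (hLagrange : I 0 > I 2 ∧ I 2 > I 1) :
    -- the family: at every radius, a single orbit of the symmetry group
    (∀ R : ℝ, 0 < R → ∃ z, ∀ x : Satellite.Phase,
      (x ∈ Satellite.orthFamily I ∧ Satellite.len x.2.1 = R) ↔ ∃ g, x = Satellite.act g z) ∧
    ∃ Rcrit : ℝ, 0 < Rcrit ∧ Rcrit < 2 ∧
      2 * Rcrit ^ 4 + (9 * I 1 - 6 * I 0 - 3) * Rcrit ^ 2 - 15 * I 0 + 45 * I 0 * I 1 = 0 ∧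
      -- loss of stability
      (∀ z ∈ Satellite.orthFamily I, Rcrit < Satellite.len z.2.1 → Satellite.IsStable I z) ∧
      (∀ z ∈ Satellite.orthFamily I, Satellite.len z.2.1 < Rcrit →
        Satellite.IsLinearlyUnstable I z ∧ ¬ Satellite.IsStable I z) ∧
      -- no bifurcation
      (∀ z ∈ Satellite.orthFamily I, Satellite.len z.2.1 = Rcrit →
        ¬ Satellite.IsBifurcationPoint I (Satellite.orthFamily I) z) ∧
      -- nondegeneracy of the relative equilibrium equations
      (∀ w : ℝ, w ^ 2 = (2 * Rcrit ^ 2 + 3 - 9 * I 1) / (2 * Rcrit ^ 5) →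
        (Satellite.relEqJacobian I (![0, Rcrit, 0], ![w, 0, 0])).det ≠ 0) := by
  open Satellite in
  obtain ⟨h02, h21⟩ := hLagrange
  have hI' (i : Fin 3) : I i ≠ 0 := (hpos i).ne'
  have hI1 : I 1 < 1 / 3 := by linarith
  have hfam {z : Phase} (hz : z ∈ orthFamily I) : ∃ r w : ℝ, r ≠ 0 ∧ w ≠ 0 ∧
      w ^ 2 = freqSq I |r| ∧ z.2 = baseState I r w ∧ len z.2.1 = |r| := by
    obtain ⟨r, w, hr, hw, hzy⟩ := (mem_orthFamily_iff hI').1 hz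
    refine ⟨r, w, hr, ?_, hw, hzy, by rw [hzy, len_baseState]⟩
    rintro rfl
    have := freqSq_pos hI1 (abs_pos.2 hr)
    rw [← hw] at this
    simp at this
  refine ⟨fun R hR => orthFamily_orbit hI' hI1 hR, ?_⟩
  obtain ⟨R, hR0, hR2, hR, hgt, hlt⟩ := exists_critical_radius hpos (htri 0) hI1
  refine ⟨R, hR0, hR2, hR, fun z hz hl => ?_, fun z hz hl => ?_, fun z hz _ => ?_, fun w hw => ?_⟩
  · obtain ⟨r, w, hr, hw0, hw, hzy, hlen⟩ := hfam hz
    rw [hlen] at hl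
    exact isStable_of_critPoly_pos hpos h02 h21 hr hw0 hw (hgt _ hl) hzy
  · obtain ⟨r, w, hr, hw0, hw, hzy, hlen⟩ := hfam hz
    rw [hlen] at hl
    have hneg := hlt _ (abs_pos.2 hr) hl
    exact ⟨isLinearlyUnstable_of_critPoly_neg hpos h21 hr hw0 hw hneg hzy,
      not_isStable_of_critPoly_neg hpos h02 h21 hr hw0 hw hneg hzy⟩
  · obtain ⟨r, w, hr, hw0, -, hzy, -⟩ := hfam hz
    exact not_isBifurcationPoint hpos h02 h21 hr hw0 hzy
  · have hw' : w ^ 2 = freqSq I |R| := by rw [hw, abs_of_pos hR0, freqSq]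
    have hw0 : w ≠ 0 := by
      rintro rfl
      have := freqSq_pos hI1 hR0
      rw [abs_of_pos hR0] at hw'
      rw [← hw'] at this
      simp at this
    exact det_relEqJacobian_axis_ne_zero h02 h21 hR0.ne' hw0 hw'
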